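/- Let $k\ge 2$. The infinite looped $k$-ary tree is the infinite rooted tree in which every vertex has $k$ children, ordered from left to right, and the root carries a self-loop (so the root counts as its own parent). Labeled chip-firing: when a vertex carries at least $k+1$ labeled chips it may fire, i.e. select any $k+1$ of its chips, send the $\lceil\frac{k+1}{2}\rceil$-th smallest selected chip to its parent and, for $1\le i\le k$, the $i$-th smallest of the remaining $k$ selected chips to its $i$-th leftmost child. A configuration is stable if no vertex can fire. Put $N_{k,\ell}=\frac{k^{\ell}-1}{k-1}$. Let $Z_{k,\ell}$ be the number of stable configurations that can be reached from the initial configuration with chips $1,2,\dots,N_{k,\ell}$ all at the root. Let $T_{k,\ell}$ be the number of possible orderings of the chips within a subtree consisting of $\ell$ layers in a stable configuration; that is, the number of distinct arrangements of the relative ranks $1,\dots,N_{k,\ell}$ on the $N_{k,\ell}$ positions of such a subtree, where the subtree (one chip on each vertex of its first $\ell$ layers and no chips below) ranges over all such subtrees of all stable configurations reachable from chips $1,\dots,N_{k,n}$ at the root, for all $n$. Let $A_\ell$ be the Euler zigzag number, the number of permutations $\pi$ of $\{1,\dots,\ell\}$ with $\pi_1<\pi_2>\pi_3<\cdots$. Then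 for every $\ell\ge 3$ there are only finitely many reachable stable configurations, and both $Z_{k,\ell}$ and $T_{k,\ell}$ are at most $$\binom{N_{k,\ell}-2}{\ell}\,\frac{(N_{k,\ell}-\ell-2)!}{(N_{k,\ell-1}-1)!\,(N_{k,\ell-1})!^{\,k-2}\,(N_{k,\ell-2}-1)!\,(N_{k,\ell-2})!^{\,k-2}\,\prod_{i=1}^{\ell-3}(N_{k,i})!^{\,k-1}}\;A_\ell\;\prod_{i=1}^{\ell-1}T_{k,i}^{\,k-1}.$$ -/

import Mathlib

namespace ChipFiring

/-- `N k l = (k ^ l - 1) / (k - 1)`, the number of vertices in the first `l` layers of the `k`-ary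
tree (the division is exact for `k ≥ 2`). -/
def N (k l : ℕ) : ℕ := (k ^ l - 1) / (k - 1)

/-! The vertices of the infinite looped `k`-ary tree are numbered breadth first by `ℕ`: the root is
`0` and the `j`-th leftmost child (`1 ≤ j ≤ k`) of the vertex `v` is `k * v + j`. -/

/-- The upward neighbour of a vertex: its parent, or the root itself (self-loop) for the root. -/
def parent (k v : ℕ) : ℕ := if v = 0 then 0 else (v - 1) / k

/-- The vertex at breadth-first index `i` in the subtree rooted at `v`. In particular
`subVertex k 0 i = i` for `k ≥ 1`, and `Set.range (subVertex k v)` is the full subtree at `v`. -/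
def subVertex (k v : ℕ) : ℕ → ℕ
  | 0 => v
  | i + 1 => k * subVertex k v (i / k) + (i % k + 1)
  termination_by i => i
  decreasing_by exact Nat.lt_succ_of_le (Nat.div_le_self i k)

/-- A placement of `m` labeled chips on the tree: `σ c` is the vertex carrying the chip `c`.
The chips are labeled by `Fin m`, ordered as usual. -/
abbrev Config (m : ℕ) : Type := Fin m → ℕ

/-- One firing. Some vertex `v` selects a set `S` of `k + 1` of its chips; the
`⌈(k + 1) / 2⌉`-th smallest chip `p` of `S` goes to the parent of `v`, the `i`-th smallest of the
other selected chips goes to the `i`-th leftmost child of `v`, and no other chip moves. -/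
def Fires (k : ℕ) {m : ℕ} (σ τ : Config m) : Prop :=
  ∃ (v : ℕ) (S : Finset (Fin m)) (p : Fin m),
    S.card = k + 1 ∧ (∀ c ∈ S, σ c = v) ∧
    p ∈ S ∧ (S.filter (fun d => d ≤ p)).card = (k + 2) / 2 ∧
    τ p = parent k v ∧
    (∀ c ∈ S.erase p, τ c = k * v + ((S.erase p).filter (fun d => d ≤ c)).card) ∧
    ∀ c, c ∉ S → τ c = σ c

/-- No vertex can fire, i.e. no vertex carries `k + 1` or more chips. -/
def Stable (k : ℕ) {m : ℕ} (σ : Config m) : Prop :=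
  ∀ v : ℕ, (Finset.univ.filter (fun c => σ c = v)).card < k + 1

/-- The stable configurations that can be reached by finitely many firings from the configuration
with the chips `1, …, N k l` all at the root. -/
def stableConfigs (k l : ℕ) : Set (Config (N k l)) :=
  {σ | Relation.ReflTransGen (Fires k) (fun _ => 0) σ ∧ Stable k σ}

/-- `Z k l`: the number of possible stable configurations with `N k l` chips at the root. -/
noncomputable def Z (k l : ℕ) : ℕ := (stableConfigs k l).ncard

/-- `IsSubtreeOrdering k l σ v w`: in the configuration `σ`, the chips on the subtree rooted at `v`
occupy exactly its first `l` layers, one chip per vertex, and they are ordered as `w`: for each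
breadth-first index `j` in the subtree, the chip there is the `w j`-th smallest (counting from
zero) of the chips on the subtree. Here `f` lists those chips increasingly. -/
def IsSubtreeOrdering (k l : ℕ) {m : ℕ} (σ : Config m) (v : ℕ)
    (w : Equiv.Perm (Fin (N k l))) : Prop :=
  ∃ f : Fin (N k l) ↪o Fin m,
    Set.range f = {c | σ c ∈ Set.range (subVertex k v)} ∧
    ∀ j : Fin (N k l), σ (f (w j)) = subVertex k v j

/-- The possible orderings of the chips within a subtree consisting of `l` layers in a stable
configuration (reached from `N k n` chips at the root, for any `n`). -/
def subtreeOrderings (k l : ℕ) : Set (Equiv.Perm (Fin (N k l))) :=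
  {w | ∃ (n : ℕ) (σ : Config (N k n)) (v : ℕ), σ ∈ stableConfigs k n ∧ IsSubtreeOrdering k l σ v w}

/-- `T k l`: the number of possible orderings of the chips within a subtree of `l` layers. -/
noncomputable def T (k l : ℕ) : ℕ := (subtreeOrderings k l).ncard

/-- The Euler zigzag number `A l`: the number of alternating permutations
`π 0 < π 1 > π 2 < ⋯` of `l` elements. -/
def eulerZigzag (l : ℕ) : ℕ :=
  (Finset.univ.filter (fun π : Equiv.Perm (Fin l) =>
    ∀ i j : Fin l, (i : ℕ) + 1 = j → if Even (i : ℕ) then π i < π j else π j < π i)).card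

/-- The right-hand side of the recursive zigzag bound. -/
noncomputable def zigzagBound (k l : ℕ) : ℚ :=
  ((N k l - 2).choose l : ℚ) *
    (((N k l - l - 2).factorial : ℚ) /
      (((N k (l - 1) - 1).factorial : ℚ) * ((N k (l - 1)).factorial : ℚ) ^ (k - 2) *
        ((N k (l - 2) - 1).factorial : ℚ) * ((N k (l - 2)).factorial : ℚ) ^ (k - 2) *
        ∏ i ∈ Finset.Icc 1 (l - 3), ((N k i).factorial : ℚ) ^ (k - 1))) *
    (eulerZigzag l : ℚ) * ∏ i ∈ Finset.Icc 1 (l - 1), (T k i : ℚ) ^ (k - 1)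

end ChipFiring

namespace ChipFiring

/-! Every bound is proved for `T`. A reachable stable configuration has one chip on each of the
first `l` layers, so it is determined by its ordering of the whole tree; hence `Z k l ≤ T k l`, and
finiteness follows.

The dynamics are controlled by a function `d` counting the firings each vertex still has to make. It
satisfies a Laplacian balance equation with the chip counts, and the last firings of a vertex
interlace with those of its children (`Good`). Consequently, in these controlled rounds a firing
vertex carries exactly `k + 1` chips (`Good.tight`), and `d` vanishes in every stable configuration.
Just before the last firing of `w` its children are empty, and afterwards they keep the chips just
received; so sibling chips end up sorted (`Run.siblings_sorted`). Permuting the `k` child blocks of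
an ordering therefore never gives repetitions, which yields `T k (l+1) * k! * N_l!^k ≤ N_(l+1)! *
T_l^k` (`T_succ_mul_le`).

After cancellation the zigzag bound is `N_(l-1) N_(l-2) (N_l - 2)! / l! * A_l * ∏ (T_i /
N_i!)^(k-1)`. The recursive bound carries it from `l` to `l + 1` because `(l+1) A_l ≤ 2 A_(l+1)` and
`N_(l+1) N_(l-2) ≤ N_l N_(l-1)`.

It remains to treat `l = 3`. For `k ≥ 4` the recursive bound suffices. For `k = 3` the extreme ranks
of sibling subtrees are sorted too, and counting the corresponding words gives the factor 16913
(`T_three_three_le`). For `k = 2` a finer study of the dynamics determines enough order relations in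
three layers to leave at most 20 orderings (`T_two_three_le`). -/

/-! ### Arithmetic of layer sizes and geometry of the tree. -/

lemma N_zero (k : ℕ) : N k 0 = 0 := by simp [N]

lemma N_eq_geom_sum {k : ℕ} (hk : 2 ≤ k) (l : ℕ) : N k l = ∑ i ∈ Finset.range l, k ^ i :=
  (Nat.geomSum_eq hk l).symm

lemma N_succ {k : ℕ} (hk : 2 ≤ k) (l : ℕ) : N k (l + 1) = k * N k l + 1 := by
  rw [N_eq_geom_sum hk, N_eq_geom_sum hk, Finset.sum_range_succ', Finset.mul_sum]
  simp [pow_succ, mul_comm]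

lemma N_one {k : ℕ} (hk : 2 ≤ k) : N k 1 = 1 := by
  simp [N_succ hk, N_zero]

lemma parent_child {k : ℕ} (v : ℕ) (i : Fin k) : parent k (k * v + i + 1) = v := by
  have hi := i.2
  rw [parent, if_neg (by omega), Nat.add_sub_cancel, Nat.mul_add_div (by omega),
    Nat.div_eq_of_lt hi, add_zero]

lemma parent_zero (k : ℕ) : parent k 0 = 0 := by simp [parent]

lemma exists_child {k : ℕ} (hk : 2 ≤ k) {x : ℕ} (hx : x ≠ 0) :
    ∃ i : Fin k, x = k * parent k x + i + 1 := by
  refine ⟨⟨(x - 1) % k, Nat.mod_lt _ (by omega)⟩, ?_⟩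
  rw [parent, if_neg hx]
  have := Nat.div_add_mod (x - 1) k
  simp only
  omega

lemma child_inj {k v w : ℕ} {i j : Fin k} (h : k * v + i + 1 = k * w + j + 1) :
    v = w ∧ i = j := by
  have hv : v = w := by rw [← parent_child v i, h, parent_child]
  subst hv
  exact ⟨rfl, Fin.ext (by omega)⟩

lemma child_eq_iff {k : ℕ} (hk : 2 ≤ k) {x v : ℕ} :
    (∃ i : Fin k, x = k * v + i + 1) ↔ x ≠ 0 ∧ parent k x = v := by
  constructor
  · rintro ⟨i, rfl⟩
    exact ⟨by omega, parent_child v i⟩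
  · rintro ⟨hx, rfl⟩
    exact exists_child hk hx

lemma lt_child {k : ℕ} (hk : 2 ≤ k) (v i : ℕ) : v < k * v + i + 1 := by
  have : 1 * v ≤ k * v := Nat.mul_le_mul_right v (by omega)
  omega

lemma parent_lt {k : ℕ} (hk : 2 ≤ k) {x : ℕ} (hx : x ≠ 0) : parent k x < x := by
  obtain ⟨i, hi⟩ := exists_child hk hx
  have := lt_child hk (parent k x) i
  omega

lemma subVertex_child {k : ℕ} (v a : ℕ) (i : Fin k) :
    subVertex k v (k * a + i + 1) = k * subVertex k v a + i + 1 := by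
  have hi := i.2
  rw [subVertex, Nat.mul_add_div (by omega), Nat.div_eq_of_lt hi, Nat.mul_add_mod,
    Nat.mod_eq_of_lt hi, add_zero, add_assoc]

lemma subVertex_at_zero (k v : ℕ) : subVertex k v 0 = v := by rw [subVertex]

/-- Induction along the tree: from a vertex to its children. -/
lemma vertex_induction {k : ℕ} (hk : 2 ≤ k) {P : ℕ → Prop} (h0 : P 0)
    (hs : ∀ a (i : Fin k), P a → P (k * a + i + 1)) (x : ℕ) : P x := by
  induction x using Nat.strong_induction_on with
  | _ x ih =>
    by_cases hx : x = 0
    · rwa [hx]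
    · obtain ⟨i, hi⟩ := exists_child hk hx
      rw [hi]
      exact hs _ _ (ih _ (parent_lt hk hx))

lemma subVertex_subVertex {k : ℕ} (hk : 2 ≤ k) (v a i : ℕ) :
    subVertex k (subVertex k v a) i = subVertex k v (subVertex k a i) := by
  induction i using vertex_induction hk with
  | h0 => simp [subVertex_at_zero]
  | hs b i ih => simp only [subVertex_child, ih]

lemma subVertex_zero {k : ℕ} (hk : 2 ≤ k) (i : ℕ) : subVertex k 0 i = i := by
  induction i using vertex_induction hk with
  | h0 => simp [subVertex_at_zero]
  | hs b i ih => simp only [subVertex_child, ih]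

/-- The set of vertices of the subtree rooted at `u`. -/
def Sub (k u : ℕ) : Set ℕ := Set.range (subVertex k u)

lemma self_mem_Sub (k u : ℕ) : u ∈ Sub k u := ⟨0, subVertex_at_zero k u⟩

lemma child_mem_Sub {k u x : ℕ} (h : x ∈ Sub k u) (i : Fin k) : k * x + i + 1 ∈ Sub k u := by
  obtain ⟨a, rfl⟩ := h
  exact ⟨k * a + i + 1, subVertex_child u a i⟩

lemma mem_Sub_cases {k : ℕ} (hk : 2 ≤ k) {u x : ℕ} (h : x ∈ Sub k u) :
    x = u ∨ ∃ y ∈ Sub k u, ∃ i : Fin k, x = k * y + i + 1 := by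
  obtain ⟨a, rfl⟩ := h
  by_cases ha : a = 0
  · left; rw [ha, subVertex_at_zero]
  · obtain ⟨i, hi⟩ := exists_child hk ha
    right
    exact ⟨_, ⟨parent k a, rfl⟩, i, by rw [← subVertex_child, ← hi]⟩

lemma le_of_mem_Sub {k : ℕ} (hk : 2 ≤ k) {u x : ℕ} (h : x ∈ Sub k u) : u ≤ x := by
  obtain ⟨a, rfl⟩ := h
  induction a using vertex_induction hk with
  | h0 => simp [subVertex_at_zero]
  | hs b i ih =>
    rw [subVertex_child]
    have := lt_child hk (subVertex k u b) i
    omega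

lemma Sub_zero {k : ℕ} (hk : 2 ≤ k) (x : ℕ) : x ∈ Sub k 0 := ⟨x, subVertex_zero hk x⟩

lemma mem_Sub_of_child_mem {k : ℕ} (hk : 2 ≤ k) {u x : ℕ} {i : Fin k}
    (h : k * x + i + 1 ∈ Sub k u) (hne : k * x + i + 1 ≠ u) : x ∈ Sub k u := by
  rcases mem_Sub_cases hk h with h' | ⟨y, hy, j, hj⟩
  · exact absurd h' hne
  · rw [(child_inj hj).1]; exact hy

lemma mem_Sub_trans {k : ℕ} (hk : 2 ≤ k) {u x y : ℕ} (hx : x ∈ Sub k u) (hy : y ∈ Sub k x) :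
    y ∈ Sub k u := by
  obtain ⟨a, rfl⟩ := hx
  obtain ⟨b, rfl⟩ := hy
  exact ⟨_, (subVertex_subVertex hk u a b).symm⟩

lemma mem_Sub_iff_child {k : ℕ} (hk : 2 ≤ k) {u x : ℕ} :
    x ∈ Sub k u ↔ x = u ∨ ∃ i : Fin k, x ∈ Sub k (k * u + i + 1) := by
  constructor
  · rintro ⟨a, rfl⟩
    induction a using vertex_induction hk with
    | h0 => left; exact subVertex_at_zero k u
    | hs b i ih =>
      right
      rw [subVertex_child]
      rcases ih with h | ⟨j, hj⟩
      · exact ⟨i, by rw [h]; exact self_mem_Sub _ _⟩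
      · exact ⟨j, child_mem_Sub hj i⟩
  · rintro (rfl | ⟨i, hi⟩)
    · exact self_mem_Sub _ _
    · exact mem_Sub_trans hk (child_mem_Sub (self_mem_Sub _ _) i) hi

lemma Sub_child_disjoint {k : ℕ} (hk : 2 ≤ k) {u x : ℕ} {i j : Fin k}
    (hi : x ∈ Sub k (k * u + i + 1)) (hj : x ∈ Sub k (k * u + j + 1)) : i = j := by
  obtain ⟨a, rfl⟩ := hi
  induction a using vertex_induction hk with
  | h0 =>
    rw [subVertex_at_zero] at hj
    rcases mem_Sub_cases hk hj with h | ⟨y, hy, r, hr⟩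
    · exact (child_inj h).2
    · have := le_of_mem_Sub hk hy
      have h1 := (child_inj hr).1
      have := lt_child hk u j
      omega
  | hs b r ih =>
    rw [subVertex_child] at hj
    by_cases h : k * subVertex k (k * u + i + 1) b + r + 1 = k * u + j + 1
    · have h1 := (child_inj h).1
      have h2 := le_of_mem_Sub hk (⟨b, rfl⟩ : subVertex k (k * u + i + 1) b ∈ Sub k (k * u + i + 1))
      have := lt_child hk u i
      omega
    · exact ih (mem_Sub_of_child_mem hk hj h)

lemma subVertex_injective {k : ℕ} (hk : 2 ≤ k) (v : ℕ) : Function.Injective (subVertex k v) := by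
  intro a
  induction a using vertex_induction hk with
  | h0 =>
    intro b hb
    by_contra hne
    obtain ⟨j, hj⟩ := exists_child hk (Ne.symm hne)
    rw [hj, subVertex_child, subVertex_at_zero] at hb
    have := le_of_mem_Sub hk (⟨parent k b, rfl⟩ : subVertex k v (parent k b) ∈ Sub k v)
    have := lt_child hk (subVertex k v (parent k b)) j
    omega
  | hs a i ih =>
    intro b hb
    by_cases h0 : b = 0
    · subst h0
      rw [subVertex_child, subVertex_at_zero] at hb
      have := le_of_mem_Sub hk (⟨a, rfl⟩ : subVertex k v a ∈ Sub k v)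
      have := lt_child hk (subVertex k v a) i
      omega
    · obtain ⟨j, hj⟩ := exists_child hk h0
      rw [hj, subVertex_child, subVertex_child] at hb
      obtain ⟨h1, h2⟩ := child_inj hb
      rw [hj, ← ih h1, h2]

/-- The number of edges from the root to a vertex. -/
def depth (k : ℕ) (x : ℕ) : ℕ :=
  if h : x = 0 ∨ k < 2 then 0 else depth k (parent k x) + 1
  termination_by x
  decreasing_by exact parent_lt (by omega) (by tauto)

lemma depth_zero (k : ℕ) : depth k 0 = 0 := by rw [depth]; simp

lemma depth_child {k : ℕ} (hk : 2 ≤ k) (x : ℕ) (i : Fin k) :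
    depth k (k * x + i + 1) = depth k x + 1 := by
  rw [depth, dif_neg (by omega), parent_child]

lemma child_lt_N_succ_iff {k : ℕ} (hk : 2 ≤ k) (x l : ℕ) (i : Fin k) :
    k * x + i + 1 < N k (l + 1) ↔ x < N k l := by
  have hi := i.2
  rw [N_succ hk]
  constructor
  · intro h
    by_contra! h'
    have := Nat.mul_le_mul_left k h'
    omega
  · intro h
    have := Nat.mul_le_mul_left k (Nat.succ_le_of_lt h)
    rw [Nat.mul_succ] at this
    omega

lemma lt_N_iff_depth {k : ℕ} (hk : 2 ≤ k) (x l : ℕ) : x < N k l ↔ depth k x < l := by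
  induction x using vertex_induction hk generalizing l with
  | h0 =>
    rw [depth_zero]
    cases l with
    | zero => simp [N_zero]
    | succ l => simp [N_succ hk]
  | hs a i ih =>
    rw [depth_child hk]
    cases l with
    | zero => simp [N_zero]
    | succ l => rw [child_lt_N_succ_iff hk, ih]; omega

lemma N_mono {k : ℕ} (hk : 2 ≤ k) : Monotone (N k) := by
  refine monotone_nat_of_le_succ fun l => ?_
  rw [N_succ hk]
  have : 1 * N k l ≤ k * N k l := Nat.mul_le_mul_right _ (by omega)
  omega

lemma N_pos {k : ℕ} (hk : 2 ≤ k) {l : ℕ} (hl : 1 ≤ l) : 0 < N k l := by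
  obtain ⟨l, rfl⟩ := Nat.exists_eq_succ_of_ne_zero (by omega : l ≠ 0)
  rw [Nat.succ_eq_add_one, N_succ hk]; omega

lemma depth_subVertex {k : ℕ} (hk : 2 ≤ k) (v a : ℕ) :
    depth k (subVertex k v a) = depth k v + depth k a := by
  induction a using vertex_induction hk with
  | h0 => simp [subVertex_at_zero, depth_zero]
  | hs b i ih => rw [subVertex_child, depth_child hk, depth_child hk, ih]; omega

/-! ### Effect of a single firing. -/

/-- The data of one firing at `v`: the chip `p` moves to the parent, the chips `s 0 < s 1 < ⋯` move
to the children in this order, and `p` is neither the smallest nor the largest of the chips. -/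
structure Firing (k : ℕ) {m : ℕ} (σ τ : Config m) (v : ℕ) (s : Fin k → Fin m) (p : Fin m) :
    Prop where
  mono : StrictMono s
  src : ∀ i, σ (s i) = v
  src_p : σ p = v
  ne : ∀ i, s i ≠ p
  lower : ∃ i, s i < p
  upper : ∃ i, p < s i
  dst : ∀ i, τ (s i) = k * v + i + 1
  dst_p : τ p = parent k v
  rest : ∀ c, c ≠ p → (∀ i, s i ≠ c) → τ c = σ c

/-- For `k ≥ 2` the rank `(k + 2) / 2` lies strictly between 1 and `k + 1`. That `p` is not extreme
is all that is kept of its rank. -/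
lemma Fires.exists_firing {k m : ℕ} (hk : 2 ≤ k) {σ τ : Config m} (h : Fires k σ τ) :
    ∃ v s p, Firing k σ τ v s p := by
  classical
  obtain ⟨v, S, p, hS, hv, hp, hcard, hpar, hch, hrest⟩ := h
  have hE : (S.erase p).card = k := by rw [Finset.card_erase_of_mem hp, hS]; rfl
  set s := (S.erase p).orderEmbOfFin hE with hs
  have hmem : ∀ i, s i ∈ S.erase p := fun i => Finset.orderEmbOfFin_mem _ hE i
  have hex : ∀ c ∈ S.erase p, ∃ i, s i = c := by
    intro c hc
    have : c ∈ Set.range s := by rw [hs, Finset.range_orderEmbOfFin]; exact hc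
    exact this
  have hrank : ∀ i : Fin k, ((S.erase p).filter (fun d => d ≤ s i)).card = i + 1 := by
    intro i
    have : (S.erase p).filter (fun d => d ≤ s i) = (Finset.Iic i).map s.toEmbedding := by
      ext d
      simp only [Finset.mem_filter, Finset.mem_map, Finset.mem_Iic]
      constructor
      · rintro ⟨h1, h2⟩
        obtain ⟨j, rfl⟩ := hex d h1
        exact ⟨j, s.le_iff_le.1 h2, rfl⟩
      · rintro ⟨j, hj, rfl⟩
        exact ⟨hmem j, s.le_iff_le.2 hj⟩
    rw [this, Finset.card_map, Fin.card_Iic]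
  refine ⟨v, s, p, s.strictMono, fun i => hv _ (Finset.mem_of_mem_erase (hmem i)), hv p hp,
    fun i => Finset.ne_of_mem_erase (hmem i), ?_, ?_, fun i => ?_, hpar, fun c hc hc' => ?_⟩
  · by_contra! hcon
    have : S.filter (fun d => d ≤ p) ⊆ {p} := by
      intro d hd
      rw [Finset.mem_filter] at hd
      by_contra hne
      rw [Finset.mem_singleton] at hne
      obtain ⟨i, rfl⟩ := hex d (Finset.mem_erase.2 ⟨hne, hd.1⟩)
      exact hne (le_antisymm hd.2 (hcon i))
    have := Finset.card_le_card this
    rw [hcard, Finset.card_singleton] at this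
    omega
  · by_contra! hcon
    have : S.filter (fun d => d ≤ p) = S := by
      refine Finset.filter_true_of_mem fun d hd => ?_
      by_cases hne : d = p
      · exact hne.le
      · obtain ⟨i, rfl⟩ := hex d (Finset.mem_erase.2 ⟨hne, hd⟩)
        exact hcon i
    rw [this, hS] at hcard
    omega
  · rw [hch _ (hmem i), hrank, add_assoc]
  · refine hrest c fun hcS => ?_
    obtain ⟨i, hi⟩ := hex c (Finset.mem_erase.2 ⟨hc, hcS⟩)
    exact hc' i hi

/-- The number of chips at the vertex `x`. -/
def count {m : ℕ} (σ : Config m) (x : ℕ) : ℕ := (Finset.univ.filter (fun c => σ c = x)).card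

namespace Firing

variable {k m : ℕ} {σ τ : Config m} {v : ℕ} {s : Fin k → Fin m} {p : Fin m}

lemma cases (F : Firing k σ τ v s p) (c : Fin m) :
    c = p ∨ (∃ i, c = s i) ∨ (c ≠ p ∧ (∀ i, s i ≠ c) ∧ τ c = σ c) := by
  by_cases h : c = p
  · exact Or.inl h
  by_cases h' : ∃ i, c = s i
  · exact Or.inr (Or.inl h')
  push Not at h'
  exact Or.inr (Or.inr ⟨h, fun i hi => h' i hi.symm, F.rest c h fun i hi => h' i hi.symm⟩)

lemma eq_of_dst (F : Firing k σ τ v s p) {c : Fin m} {x : ℕ} (h : τ c = x) :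
    (c = p ∧ x = parent k v) ∨ (∃ i : Fin k, c = s i ∧ x = k * v + i + 1) ∨ σ c = x := by
  rcases F.cases c with rfl | ⟨i, rfl⟩ | ⟨-, -, h'⟩
  · exact Or.inl ⟨rfl, h ▸ F.dst_p⟩
  · exact Or.inr (Or.inl ⟨i, rfl, h ▸ F.dst i⟩)
  · exact Or.inr (Or.inr (h' ▸ h))

lemma stays (F : Firing k σ τ v s p) {c : Fin m} (h : σ c ≠ v) : τ c = σ c := by
  rcases F.cases c with rfl | ⟨i, rfl⟩ | ⟨-, -, h'⟩
  · exact absurd F.src_p h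
  · exact absurd (F.src i) h
  · exact h'

lemma card_selected (F : Firing k σ τ v s p) :
    (insert p (Finset.univ.image s)).card = k + 1 := by
  rw [Finset.card_insert_of_notMem, Finset.card_image_of_injective _ F.mono.injective,
    Finset.card_univ, Fintype.card_fin]
  simp only [Finset.mem_image, Finset.mem_univ, true_and, not_exists]
  exact F.ne

lemma selected_subset (F : Firing k σ τ v s p) :
    insert p (Finset.univ.image s) ⊆ Finset.univ.filter (fun c => σ c = v) := by
  intro c hc
  simp only [Finset.mem_insert, Finset.mem_image, Finset.mem_univ, true_and] at hc
  simp only [Finset.mem_filter, Finset.mem_univ, true_and]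
  rcases hc with rfl | ⟨i, rfl⟩
  · exact F.src_p
  · exact F.src i

lemma le_count (F : Firing k σ τ v s p) : k + 1 ≤ count σ v := by
  rw [← F.card_selected]
  exact Finset.card_le_card F.selected_subset

lemma eq_of_count (F : Firing k σ τ v s p) (h : count σ v = k + 1) {c : Fin m} (hc : σ c = v) :
    c = p ∨ ∃ i, c = s i := by
  have := Finset.eq_of_subset_of_card_le F.selected_subset (by
    rw [F.card_selected]; exact h.le)
  have hc' : c ∈ insert p (Finset.univ.image s) := by
    rw [this]; simpa using hc
  simp only [Finset.mem_insert, Finset.mem_image, Finset.mem_univ, true_and] at hc'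
  exact hc'.imp id fun ⟨i, hi⟩ => ⟨i, hi.symm⟩

/-- Counts change by a row of the graph Laplacian, whichever chips are selected. The self-loop
appears as `parent k 0 = 0`. -/
lemma count_eq (F : Firing k σ τ v s p) (x : ℕ) :
    count τ x + (k + 1) * (if x = v then 1 else 0) =
      count σ x + (if x = parent k v then 1 else 0) +
        ∑ i : Fin k, (if x = k * v + i + 1 then 1 else 0) := by
  have key : ∀ ρ : Config m, count ρ x =
      ((if ρ p = x then 1 else 0) + ∑ i, (if ρ (s i) = x then 1 else 0)) +
        ∑ c ∈ (insert p (Finset.univ.image s))ᶜ, (if ρ c = x then 1 else 0) := by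
    intro ρ
    have hp : p ∉ Finset.univ.image s := by simpa using F.ne
    rw [count, Finset.card_filter, ← Finset.sum_add_sum_compl (insert p (Finset.univ.image s)),
      Finset.sum_insert hp, Finset.sum_image (fun _ _ _ _ h => F.mono.injective h)]
  have hrest : ∑ c ∈ (insert p (Finset.univ.image s))ᶜ, (if τ c = x then 1 else 0) =
      ∑ c ∈ (insert p (Finset.univ.image s))ᶜ, (if σ c = x then 1 else 0) := by
    refine Finset.sum_congr rfl fun c hc => ?_
    simp only [Finset.mem_compl, Finset.mem_insert, Finset.mem_image, Finset.mem_univ, true_and,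
      not_or, not_exists] at hc
    rw [F.rest c hc.1 hc.2]
  rw [key σ, key τ, hrest]
  simp only [F.src, F.src_p, F.dst, F.dst_p, Finset.sum_const, Finset.card_univ, Fintype.card_fin,
    smul_eq_mul, eq_comm (a := x)]
  ring

/-- The only way out of a subtree is the edge above its root, and only `p` travels upwards. -/
lemma leave (hk : 2 ≤ k) (F : Firing k σ τ v s p) {u : ℕ} {c : Fin m} (h : σ c ∈ Sub k u) :
    τ c ∈ Sub k u ∨ (c = p ∧ v = u) := by
  rcases F.cases c with rfl | ⟨i, rfl⟩ | ⟨-, -, h'⟩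
  · rw [F.src_p] at h
    rw [F.dst_p]
    rcases mem_Sub_cases hk h with h' | ⟨y, hy, i, rfl⟩
    · exact Or.inr ⟨rfl, h'⟩
    · rw [parent_child]; exact Or.inl hy
  · rw [F.src] at h
    rw [F.dst]
    exact Or.inl (child_mem_Sub h i)
  · rw [h']; exact Or.inl h

lemma enter (hk : 2 ≤ k) (F : Firing k σ τ v s p) {u : ℕ} {c : Fin m} (h : τ c ∈ Sub k u) :
    σ c ∈ Sub k u ∨ ∃ i : Fin k, c = s i ∧ u = k * v + i + 1 := by
  rcases F.cases c with rfl | ⟨i, rfl⟩ | ⟨-, -, h'⟩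
  · rw [F.dst_p] at h
    rw [F.src_p]
    by_cases h0 : v = 0
    · rw [h0, parent_zero] at h
      rw [h0]; exact Or.inl h
    · obtain ⟨i, hi⟩ := exists_child hk h0
      rw [hi]; exact Or.inl (child_mem_Sub h i)
  · rw [F.dst] at h
    rw [F.src]
    by_cases hu : k * v + i + 1 = u
    · exact Or.inr ⟨i, rfl, hu.symm⟩
    · exact Or.inl (mem_Sub_of_child_mem hk h hu)
  · rw [← h']; exact Or.inl h

lemma dst_mem (F : Firing k σ τ v s p) {u : ℕ} (h : v ∈ Sub k u) (i : Fin k) :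
    τ (s i) ∈ Sub k u := by
  rw [F.dst]; exact child_mem_Sub h i

end Firing

/-! ### Remaining firings, their balance and their interlacing. -/

/-- Initial number of firings of a vertex of height `h`. -/
def firingNumber (k : ℕ) : ℕ → ℕ
  | 0 => 0
  | h + 1 => firingNumber k h + N k (h + 1)

/-- Initially every vertex has at least `height` firings left, so claims restricted to `d w <
height` are vacuous at the start of a run. -/
lemma le_firingNumber {k : ℕ} (hk : 2 ≤ k) (h : ℕ) : h ≤ firingNumber k h := by
  induction h with
  | zero => simp
  | succ h ih =>
    rw [firingNumber]
    have := N_pos hk (l := h + 1) (by omega)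
    omega

/-- The number of layers, among the first `n` ones, below the vertex `x`. -/
def height (k n x : ℕ) : ℕ := n - 1 - depth k x

/-- `Run k n σ d`: the configuration `σ` is reached from the initial one, and `d x` is the number of
firings of `x` that are left. -/
inductive Run (k n : ℕ) : Config (N k n) → (ℕ → ℕ) → Prop
  | start : Run k n (fun _ => 0) (fun x => firingNumber k (height k n x))
  | step {σ τ : Config (N k n)} {d : ℕ → ℕ} {v : ℕ} {s : Fin k → Fin (N k n)} {p : Fin (N k n)} :
      Run k n σ d → Firing k σ τ v s p → Run k n τ (Function.update d v (d v - 1))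

lemma exists_run {k n : ℕ} (hk : 2 ≤ k) {σ : Config (N k n)}
    (h : Relation.ReflTransGen (Fires k) (fun _ => 0) σ) : ∃ d, Run k n σ d := by
  induction h with
  | refl => exact ⟨_, Run.start⟩
  | tail _ hf ih =>
    obtain ⟨d, hd⟩ := ih
    obtain ⟨v, s, p, F⟩ := hf.exists_firing hk
    exact ⟨_, hd.step F⟩

lemma height_child {k : ℕ} (hk : 2 ≤ k) (n w : ℕ) (i : Fin k) :
    height k n (k * w + i + 1) = height k n w - 1 := by
  rw [height, height, depth_child hk]; omega

/-- The balance of chips and the order of the last firings. -/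
structure Good (k n : ℕ) (σ : Config (N k n)) (d : ℕ → ℕ) : Prop where
  bal : ∀ x, count σ x + d (parent k x) + ∑ i : Fin k, d (k * x + i + 1) =
    (if depth k x < n then 1 else 0) + (k + 1) * d x
  zero : ∀ x, height k n x = 0 → d x = 0
  -- Counting firings from the end, up to the height of the child, these two conditions give the
  -- order: firing `j + 1` of the parent, `j` of the child, `j` of the parent, and so on. The last
  -- firing of the parent comes after the last one of the child.
  le_parent : ∀ w (i : Fin k) j, j ≤ height k n (k * w + i + 1) → j ≤ d (k * w + i + 1) → j ≤ d w
  le_child : ∀ w (i : Fin k) j, j ≤ height k n (k * w + i + 1) → j + 1 ≤ d w →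
    j ≤ d (k * w + i + 1)

/-- Interlacing bounds `d` below by `d v` at the parent and by `d v - 1` at each child. The balance
then allows at most `1 + (k+1) d v - d v - k (d v - 1) = k + 1` chips at `v`, so a vertex able to
fire makes all these estimates equalities. -/
lemma Good.tight {k n : ℕ} (hk : 2 ≤ k) {σ : Config (N k n)} {d : ℕ → ℕ} (G : Good k n σ d) {v : ℕ}
    (hc : k + 1 ≤ count σ v) (hd : d v ≤ height k n v) :
    1 ≤ d v ∧ d (parent k v) = d v ∧ (∀ i : Fin k, d (k * v + i + 1) + 1 = d v) ∧
      count σ v = k + 1 := by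
  have hbal := G.bal v
  have h1 : 1 ≤ d v := by
    by_contra! h
    rw [Nat.lt_one_iff.1 h] at hbal
    split_ifs at hbal <;> omega
  obtain ⟨j, hj⟩ := Nat.exists_eq_add_of_le' h1
  have hpar : d v ≤ d (parent k v) := by
    by_cases h0 : v = 0
    · rw [h0, parent_zero]
    · obtain ⟨i, hi⟩ := exists_child hk h0
      refine G.le_parent (parent k v) i (d v) ?_ ?_ <;> rw [← hi]
      exact hd
  have hch : ∀ i : Fin k, j ≤ d (k * v + i + 1) := by
    intro i
    refine G.le_child v i j ?_ hj.ge
    rw [height_child hk]; omega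
  have hsum : ∑ i : Fin k, j ≤ ∑ i : Fin k, d (k * v + i + 1) := Finset.sum_le_sum fun i _ => hch i
  have hsum' : ∑ i : Fin k, j = k * j := by simp
  have hif : (if depth k v < n then 1 else 0) ≤ 1 := by split_ifs <;> omega
  have hexp : (k + 1) * d v = k * j + k + d v := by rw [hj]; ring
  have heq : ∑ i : Fin k, j = ∑ i : Fin k, d (k * v + i + 1) := by omega
  refine ⟨h1, by omega, fun i => ?_, by omega⟩
  have := (Finset.sum_eq_sum_iff_of_le fun i _ => hch i).1 heq i (Finset.mem_univ i)
  omega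

/-- With `d v = 0` the balance leaves at most one chip at `v`. Hence the subtraction `d v - 1` in
`Run.step` never truncates. -/
lemma Good.pos {k n : ℕ} {σ : Config (N k n)} {d : ℕ → ℕ} (G : Good k n σ d) {v : ℕ} (hk : 2 ≤ k)
    (hc : k + 1 ≤ count σ v) : 1 ≤ d v := by
  have hbal := G.bal v
  by_contra! h
  rw [Nat.lt_one_iff.1 h] at hbal
  split_ifs at hbal <;> omega

lemma Good.start {k n : ℕ} (hk : 2 ≤ k) (hn : 1 ≤ n) :
    Good k n (fun _ => 0) (fun x => firingNumber k (height k n x)) := by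
  have hmono : Monotone (firingNumber k) :=
    monotone_nat_of_le_succ fun h => by rw [firingNumber]; omega
  refine ⟨fun x => ?_, fun x hx => ?_, fun w i j h1 h2 => ?_, fun w i j h1 h2 => ?_⟩
  · simp only [height_child hk, Finset.sum_const, Finset.card_univ, Fintype.card_fin, smul_eq_mul]
    by_cases h0 : x = 0
    · subst h0
      have hh : height k n 0 = n - 1 := by rw [height, depth_zero]; omega
      have hc : count (fun _ : Fin (N k n) => 0) 0 = N k n := by simp [count]
      rw [parent_zero, hc, hh, depth_zero, if_pos (by omega)]
      obtain ⟨n, rfl⟩ := Nat.exists_eq_add_of_le' hn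
      cases n with
      | zero => simp [firingNumber, N_one hk]
      | succ n =>
        simp only [Nat.add_sub_cancel, firingNumber, N_succ hk (n + 1)]
        ring
    · have hc : count (fun _ : Fin (N k n) => 0) x = 0 := by simp [count, Ne.symm h0]
      obtain ⟨i, hi⟩ := exists_child hk h0
      have hdep : depth k x = depth k (parent k x) + 1 := by
        conv_lhs => rw [hi]
        exact depth_child hk _ i
      rw [hc]
      by_cases hlt : depth k x < n
      · rw [if_pos hlt]
        have hp : height k n (parent k x) = height k n x + 1 := by rw [height, height]; omega
        rw [hp]
        cases hh : height k n x with
        | zero => simp [firingNumber, N_one hk]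
        | succ h =>
          simp only [Nat.add_sub_cancel, firingNumber, N_succ hk (h + 1)]
          ring
      · have h1 : height k n x = 0 := by rw [height]; omega
        have h2 : height k n (parent k x) = 0 := by rw [height]; omega
        simp [hlt, h1, h2, firingNumber]
  · simp [hx, firingNumber]
  · exact h2.trans (hmono (by rw [height_child hk]; omega))
  · exact h1.trans (le_firingNumber hk _)

lemma Good.step {k n : ℕ} (hk : 2 ≤ k) {σ τ : Config (N k n)} {d : ℕ → ℕ} {v : ℕ}
    {s : Fin k → Fin (N k n)} {p : Fin (N k n)} (G : Good k n σ d) (F : Firing k σ τ v s p) :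
    Good k n τ (Function.update d v (d v - 1)) := by
  have hpos := G.pos hk F.le_count
  have hd : ∀ x, Function.update d v (d v - 1) x + (if x = v then 1 else 0) = d x := by
    intro x
    by_cases h : x = v
    · subst h; simp; omega
    · simp [h]
  have htight := fun h => G.tight hk F.le_count h
  have hdv : Function.update d v (d v - 1) v = d v - 1 := by simp
  have hdne : ∀ x, x ≠ v → Function.update d v (d v - 1) x = d x := fun x hx => by simp [hx]
  refine ⟨fun x => ?_, fun x hx => ?_, fun w i j h1 h2 => ?_, fun w i j h1 h2 => ?_⟩
  · have hbal := G.bal x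
    have hcount := F.count_eq x
    have hdsum : ∑ i : Fin k, d (k * x + i + 1) =
        ∑ i : Fin k, Function.update d v (d v - 1) (k * x + i + 1) +
          ∑ i : Fin k, (if k * x + i + 1 = v then 1 else 0) := by
      rw [← Finset.sum_add_distrib]
      exact Finset.sum_congr rfl fun i _ => (hd _).symm
    rw [← hd x, ← hd (parent k x), hdsum] at hbal
    have hind : ∀ a b : ℕ, ∑ i : Fin k, (if k * a + i + 1 = b then 1 else 0) =
        if b ≠ 0 ∧ parent k b = a then 1 else 0 := by
      intro a b
      by_cases h : b ≠ 0 ∧ parent k b = a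
      · obtain ⟨i, rfl⟩ := (child_eq_iff hk).2 h
        rw [if_pos h, Finset.sum_eq_single i]
        · simp
        · intro j _ hj
          exact if_neg fun he => hj (child_inj he).2
        · simp
      · rw [if_neg h]
        refine Finset.sum_eq_zero fun i _ => if_neg fun he => h ((child_eq_iff hk).1 ⟨i, he.symm⟩)
    have h2 := hind x v
    have h3 : ∑ i : Fin k, (if x = k * v + i + 1 then 1 else 0) =
        if x ≠ 0 ∧ parent k x = v then 1 else 0 := by
      rw [← hind v x]
      simp only [eq_comm (a := x)]
    rw [h3] at hcount
    rw [h2] at hbal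
    -- Adjacency is symmetric, the self-loop included: arrivals at `x` from `v` match the drop of
    -- the neighbouring terms of `d` in the balance at `x`.
    have hsym : (if x = parent k v then 1 else 0) + (if x ≠ 0 ∧ parent k x = v then 1 else 0) =
        (if parent k x = v then 1 else 0) + (if v ≠ 0 ∧ parent k v = x then 1 else 0) := by
      by_cases hx : x = 0 <;> by_cases hv : v = 0
      · subst hx; subst hv; simp [parent_zero]
      · subst hx; simp [parent_zero, hv, Ne.symm hv, eq_comm]
      · subst hv; simp [parent_zero, hx, eq_comm]
      · simp [hx, hv, eq_comm, add_comm]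
    rw [mul_add] at hbal
    omega
  · have := hd x
    have := G.zero x hx
    omega
  · have h2' : j ≤ d (k * w + i + 1) := by have := hd (k * w + i + 1); omega
    have h3 := G.le_parent w i j h1 h2'
    by_cases hw : w = v
    · subst hw
      rw [hdv]
      -- Otherwise `w` fires with exactly `j` firings left; tightness then leaves each child only `j
      -- - 1`, against the assumption on the child.
      by_contra hcon
      have hj : j = d w := by omega
      have := (htight (by rw [height_child hk] at h1; omega)).2.2.1 i
      omega
    · rw [hdne w hw]; exact h3
  · have h2' : j + 1 ≤ d w := by have := hd w; omega
    have h3 := G.le_child w i j h1 h2'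
    by_cases hx : k * w + i + 1 = v
    · have hw : w ≠ v := by have := lt_child hk w i; omega
      rw [hdne w hw] at h2
      rw [hx] at h1 h3 ⊢
      rw [hdv]
      by_contra hcon
      have := (htight (by omega)).2.1
      rw [← hx, parent_child, hx] at this
      omega
    · rw [hdne _ hx]; exact h3

lemma Run.good {k n : ℕ} (hk : 2 ≤ k) (hn : 1 ≤ n) {σ : Config (N k n)} {d : ℕ → ℕ}
    (h : Run k n σ d) : Good k n σ d := by
  induction h with
  | start => exact Good.start hk hn
  | step _ F ih => exact ih.step hk F

/-- In a stable configuration all firings are done. -/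
lemma Good.eq_zero_of_stable {k n : ℕ} (hk : 2 ≤ k) {σ : Config (N k n)} {d : ℕ → ℕ}
    (G : Good k n σ d) (hσ : Stable k σ) (x : ℕ) : d x = 0 := by
  by_cases h0 : d 0 = 0
  · induction x using vertex_induction hk with
    | h0 => exact h0
    | hs a i ih =>
      by_cases hh : height k n (k * a + i + 1) = 0
      · exact G.zero _ hh
      · by_contra hd
        have := G.le_parent a i 1 (by omega) (by omega)
        omega
  · exfalso
    -- If every child had fewer firings left than `w`, the balance would put at least `k + 1` chips
    -- on `w`, contrary to stability. Following such children from the root reaches depth `n`, where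
    -- `d` must be zero.
    have hstep : ∀ w, 1 ≤ d w → d (parent k w) ≤ d w →
        ∃ i : Fin k, d w ≤ d (k * w + i + 1) := by
      intro w hw hp
      by_contra! hcon
      have hbal := G.bal w
      have hc : count σ w < k + 1 := hσ w
      have hdep : depth k w < n := by
        by_contra hdep
        have := G.zero w (by rw [height]; omega)
        omega
      have hsum : ∑ i : Fin k, d (k * w + i + 1) ≤ ∑ i : Fin k, (d w - 1) :=
        Finset.sum_le_sum fun i _ => by have := hcon i; omega
      rw [Finset.sum_const, Finset.card_univ, Fintype.card_fin, smul_eq_mul] at hsum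
      rw [if_pos hdep] at hbal
      obtain ⟨j, hj⟩ := Nat.exists_eq_add_of_le' hw
      rw [hj, Nat.add_sub_cancel] at hsum
      have hexp : (k + 1) * d w = k * j + k + d w := by rw [hj]; ring
      omega
    have hpath : ∀ i, ∃ w, depth k w = i ∧ 1 ≤ d w ∧ d (parent k w) ≤ d w := by
      intro i
      induction i with
      | zero => exact ⟨0, depth_zero k, by omega, by rw [parent_zero]⟩
      | succ i ih =>
        obtain ⟨w, h1, h2, h3⟩ := ih
        obtain ⟨j, hj⟩ := hstep w h2 h3
        exact ⟨k * w + j + 1, by rw [depth_child hk, h1], by omega, by rw [parent_child]; exact hj⟩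
    obtain ⟨w, h1, h2, -⟩ := hpath n
    have := G.zero w (by rw [height]; omega)
    omega

lemma Good.count_of_zero {k n : ℕ} (hk : 2 ≤ k) {σ : Config (N k n)} {d : ℕ → ℕ}
    (G : Good k n σ d) (hd : ∀ x, d x = 0) (x : ℕ) :
    count σ x = if x < N k n then 1 else 0 := by
  have := G.bal x
  simp only [hd, Finset.sum_const_zero] at this
  simp only [lt_N_iff_depth hk]
  omega

/-! ### Order relations between sibling subtrees. -/

lemma zero_notMem_Sub_child {k : ℕ} (hk : 2 ≤ k) (w : ℕ) (i : Fin k) : 0 ∉ Sub k (k * w + i + 1) :=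
  fun h => by have := le_of_mem_Sub hk h; omega

lemma notMem_Sub_child {k : ℕ} (hk : 2 ≤ k) (w : ℕ) (i : Fin k) : w ∉ Sub k (k * w + i + 1) :=
  fun h => by have := le_of_mem_Sub hk h; have := lt_child hk w i; omega

/-- Extremal chips of sibling subtrees are ordered like the siblings. -/
lemma Run.exists_in_sibling {k n : ℕ} (hk : 2 ≤ k) {r : Fin (N k n) → Fin (N k n) → Prop}
    (htrans : ∀ a b c, r a b → r b c → r a c) {i j : Fin k}
    (hr : ∀ {σ τ : Config (N k n)} {v s p}, Firing k σ τ v s p →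
      (∃ a, r (s a) p) ∧ r (s i) (s j))
    {σ : Config (N k n)} {d : ℕ → ℕ} (h : Run k n σ d) (w : ℕ) (c : Fin (N k n))
    (hc : σ c ∈ Sub k (k * w + j + 1)) : ∃ c', σ c' ∈ Sub k (k * w + i + 1) ∧ r c' c := by
  induction h generalizing w c with
  | start => exact absurd hc (zero_notMem_Sub_child hk w j)
  | @step σ τ d v s p _ F ih =>
    obtain ⟨⟨a, ha⟩, hs⟩ := hr F
    rcases F.enter hk hc with h | ⟨b, rfl, hb⟩
    · obtain ⟨c', hc', hlt⟩ := ih w c h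
      -- A witness that leaves its subtree is the chip `p` sent up by the subtree's root; the
      -- selected chip `s a`, even more extreme, stays inside and replaces it.
      rcases F.leave hk hc' with h' | ⟨rfl, rfl⟩
      · exact ⟨c', h', hlt⟩
      · exact ⟨s a, F.dst_mem (self_mem_Sub _ _) a, htrans _ _ _ ha hlt⟩
    · obtain ⟨rfl, rfl⟩ := child_inj hb
      exact ⟨s i, by rw [F.dst]; exact self_mem_Sub _ _, hs⟩

lemma Run.exists_lt {k n : ℕ} (hk : 2 ≤ k) {σ : Config (N k n)} {d : ℕ → ℕ} (h : Run k n σ d)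
    {i j : Fin k} (hij : i < j) {w : ℕ} {c : Fin (N k n)} (hc : σ c ∈ Sub k (k * w + j + 1)) :
    ∃ c', σ c' ∈ Sub k (k * w + i + 1) ∧ c' < c :=
  h.exists_in_sibling hk (r := (· < ·)) (fun _ _ _ => lt_trans)
    (fun F => ⟨F.lower, F.mono hij⟩) w c hc

lemma Run.exists_gt {k n : ℕ} (hk : 2 ≤ k) {σ : Config (N k n)} {d : ℕ → ℕ} (h : Run k n σ d)
    {i j : Fin k} (hij : i < j) {w : ℕ} {c : Fin (N k n)} (hc : σ c ∈ Sub k (k * w + i + 1)) :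
    ∃ c', σ c' ∈ Sub k (k * w + j + 1) ∧ c < c' :=
  h.exists_in_sibling hk (r := (· > ·)) (fun _ _ _ => gt_trans)
    (fun F => ⟨F.upper, F.mono hij⟩) w c hc

lemma Good.child_eq_zero {k n : ℕ} {σ : Config (N k n)} {d : ℕ → ℕ} (G : Good k n σ d) {w : ℕ}
    (hw : d w = 0) (i : Fin k) : d (k * w + i + 1) = 0 := by
  by_cases hh : height k n (k * w + i + 1) = 0
  · exact G.zero _ hh
  · by_contra hd
    have := G.le_parent w i 1 (by omega) (by omega)
    omega

/-- After the last firing of `w`, the chips on its children are ordered. -/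
lemma Run.siblings_sorted {k n : ℕ} (hk : 2 ≤ k) (hn : 1 ≤ n) {σ : Config (N k n)} {d : ℕ → ℕ}
    (h : Run k n σ d) {w : ℕ} (hw : d w = 0) {i j : Fin k} (hij : i < j) {c c' : Fin (N k n)}
    (hc : σ c = k * w + i + 1) (hc' : σ c' = k * w + j + 1) : c < c' := by
  induction h generalizing c c' with
  | start => exact absurd hc (Nat.succ_ne_zero _).symm
  | @step σ τ d v s p hrun F ih =>
    have G := hrun.good hk hn
    have hpos := G.pos hk F.le_count
    by_cases hvw : w = v
    · subst hvw
      simp only [Function.update_self] at hw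
      have hT := G.tight hk F.le_count (by
        by_contra hcon
        have := G.zero w (by omega)
        omega)
      have hch : ∀ a : Fin k, d (k * w + a + 1) = 0 := fun a => by have := hT.2.2.1 a; omega
      -- Before the last firing of `w` its children have no firings left, while `w` still owes each
      -- of them one chip. The balance forces them to be empty.
      have hempty : ∀ a : Fin k, ∀ b, σ b ≠ k * w + a + 1 := by
        intro a b hb
        have hbal := G.bal (k * w + a + 1)
        rw [parent_child, hch a] at hbal
        have hcount : 1 ≤ count σ (k * w + a + 1) :=
          Finset.card_pos.2 ⟨b, by simpa using hb⟩
        split_ifs at hbal <;> omega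
      have hval : ∀ (a : Fin k) b, τ b = k * w + a + 1 → b = s a := by
        intro a b hb
        rcases F.eq_of_dst hb with ⟨-, h⟩ | ⟨e, rfl, h⟩ | h
        · by_cases h0 : w = 0
          · rw [h0, parent_zero] at h; omega
          · have := parent_lt hk h0
            have := lt_child hk w a
            omega
        · rw [(child_inj h).2]
        · exact absurd h (hempty a b)
      rw [hval _ _ hc, hval _ _ hc']
      exact F.mono hij
    · rw [Function.update_of_ne hvw] at hw
      -- A chip arriving at a child of `w` would come from a grandchild or from `w`, but neither has
      -- firings left.
      have hback : ∀ (a : Fin k) b, τ b = k * w + a + 1 → σ b = k * w + a + 1 := by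
        intro a b hb
        rcases F.eq_of_dst hb with ⟨-, h⟩ | ⟨e, rfl, h⟩ | h
        · exfalso
          have h0 : v ≠ 0 := by
            rintro rfl
            rw [parent_zero] at h; omega
          obtain ⟨e, he⟩ := exists_child hk h0
          rw [← h] at he
          have := G.child_eq_zero (G.child_eq_zero hw a) e
          rw [← he] at this
          omega
        · exact absurd (child_inj h).1 hvw
        · exact h
      exact ih hw (hback _ _ hc) (hback _ _ hc')

/-- The facts about stable configurations that hold for every `k`. -/
lemma exists_final_run {k n : ℕ} (hk : 2 ≤ k) (hn : 1 ≤ n) {σ : Config (N k n)}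
    (h : σ ∈ stableConfigs k n) : ∃ d, Run k n σ d ∧ Good k n σ d ∧ ∀ x, d x = 0 := by
  obtain ⟨d, hd⟩ := exists_run hk h.1
  exact ⟨d, hd, hd.good hk hn, (hd.good hk hn).eq_zero_of_stable hk h.2⟩

/-! ### The binary tree: chips in the far subtree exceeding a chip at its parent. -/

/-- A left-right orientation of the binary tree: `lt` is one of the two orders on the chips and
`ρ` the child that receives the `lt`-largest chip, `l` the other child. -/
structure Oriented (n : ℕ) (lt : Fin (N 2 n) → Fin (N 2 n) → Prop) (l ρ : Fin 2) : Prop where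
  trans : ∀ {a b c}, lt a b → lt b c → lt a c
  irrefl : ∀ a, ¬ lt a a
  ne : l ≠ ρ
  mid : ∀ {σ τ : Config (N 2 n)} {v s p}, Firing 2 σ τ v s p → lt (s l) p ∧ lt p (s ρ)

lemma oriented_lt (n : ℕ) : Oriented n (· < ·) 0 1 where
  trans := lt_trans
  irrefl := lt_irrefl
  ne := by decide
  mid F := by
    obtain ⟨i, hi⟩ := F.lower
    obtain ⟨j, hj⟩ := F.upper
    have h01 := F.mono (show (0 : Fin 2) < 1 by decide)
    constructor
    · fin_cases i
      · exact hi
      · exact h01.trans hi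
    · fin_cases j
      · exact hj.trans h01
      · exact hj

lemma oriented_gt (n : ℕ) : Oriented n (· > ·) 1 0 where
  trans := gt_trans
  irrefl := lt_irrefl
  ne := by decide
  mid F := ⟨((oriented_lt n).mid F).2, ((oriented_lt n).mid F).1⟩

lemma fin_two_cases {l ρ : Fin 2} (h : l ≠ ρ) (i : Fin 2) : i = l ∨ i = ρ := by omega

/-- Two different chips of `Sub 2 u` satisfy `P`. -/
def TwoIn {n : ℕ} (σ : Config (N 2 n)) (u : ℕ) (P : Fin (N 2 n) → Prop) : Prop :=
  ∃ a b, a ≠ b ∧ (σ a ∈ Sub 2 u ∧ P a) ∧ (σ b ∈ Sub 2 u ∧ P b)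

lemma TwoIn.mono {n : ℕ} {σ : Config (N 2 n)} {u : ℕ} {P Q : Fin (N 2 n) → Prop}
    (h : TwoIn σ u P) (hPQ : ∀ a, σ a ∈ Sub 2 u → P a → Q a) : TwoIn σ u Q := by
  obtain ⟨a, b, hab, ⟨h1, h2⟩, h3, h4⟩ := h
  exact ⟨a, b, hab, ⟨h1, hPQ a h1 h2⟩, h3, hPQ b h3 h4⟩

section

variable {n : ℕ} {lt : Fin (N 2 n) → Fin (N 2 n) → Prop} {l ρ : Fin 2}

lemma Oriented.exists_far (O : Oriented n lt l ρ) {σ : Config (N 2 n)} {d : ℕ → ℕ}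
    (h : Run 2 n σ d) {w : ℕ} {c : Fin (N 2 n)} (hc : σ c ∈ Sub 2 (2 * w + l + 1)) :
    ∃ c', σ c' ∈ Sub 2 (2 * w + ρ + 1) ∧ lt c c' :=
  h.exists_in_sibling le_rfl (r := fun a b => lt b a) (fun _ _ _ h h' => O.trans h' h)
    (fun F => ⟨⟨ρ, (O.mid F).2⟩, O.trans (O.mid F).1 (O.mid F).2⟩) w c hc

lemma Oriented.mem_Sub_iff (O : Oriented n lt l ρ) {u x : ℕ} :
    x ∈ Sub 2 u ↔ x = u ∨ x ∈ Sub 2 (2 * u + l + 1) ∨ x ∈ Sub 2 (2 * u + ρ + 1) := by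
  rw [mem_Sub_iff_child le_rfl]
  constructor
  · rintro (h | ⟨i, hi⟩)
    · exact Or.inl h
    · rcases fin_two_cases O.ne i with rfl | rfl
      · exact Or.inr (Or.inl hi)
      · exact Or.inr (Or.inr hi)
  · rintro (h | h | h)
    · exact Or.inl h
    · exact Or.inr ⟨_, h⟩
    · exact Or.inr ⟨_, h⟩

lemma Oriented.le_far (O : Oriented n lt l ρ) {σ τ : Config (N 2 n)} {v s p}
    (F : Firing 2 σ τ v s p) {c : Fin (N 2 n)} (hc : c = p ∨ ∃ i, c = s i) :
    c = s ρ ∨ lt c (s ρ) := by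
  rcases hc with rfl | ⟨i, rfl⟩
  · exact Or.inr (O.mid F).2
  · rcases fin_two_cases O.ne i with rfl | rfl
    · exact Or.inr (O.trans (O.mid F).1 (O.mid F).2)
    · exact Or.inl rfl

lemma Oriented.near_le (O : Oriented n lt l ρ) {σ τ : Config (N 2 n)} {v s p}
    (F : Firing 2 σ τ v s p) {c : Fin (N 2 n)} (hc : c = p ∨ ∃ i, c = s i) :
    c = s l ∨ lt (s l) c := by
  rcases hc with rfl | ⟨i, rfl⟩
  · exact Or.inr (O.mid F).1
  · rcases fin_two_cases O.ne i with rfl | rfl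
    · exact Or.inl rfl
    · exact Or.inr (O.trans (O.mid F).1 (O.mid F).2)

/-- A chip at a vertex either stays there or is one of the selected chips. -/
lemma Firing.stays_or {k m : ℕ} {σ τ : Config m} {v : ℕ} {s : Fin k → Fin m} {p : Fin m}
    (F : Firing k σ τ v s p) (c : Fin m) : τ c = σ c ∨ (σ c = v ∧ (c = p ∨ ∃ i, c = s i)) := by
  rcases F.cases c with h | ⟨i, rfl⟩ | ⟨-, -, h⟩
  · exact Or.inr ⟨h ▸ F.src_p, Or.inl h⟩
  · exact Or.inr ⟨F.src i, Or.inr ⟨i, rfl⟩⟩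
  · exact Or.inl h

/-- The two chips are the new arrival `s ρ` and an older chip of the far subtree exceeding `a`. They
differ because `s ρ` was still at `w`. -/
lemma far_two_of_firing (O : Oriented n lt l ρ) {σ τ : Config (N 2 n)} {d : ℕ → ℕ}
    (h : Run 2 n σ d) {w : ℕ} {s p} (F : Firing 2 σ τ w s p) {P : Fin (N 2 n) → Prop}
    (hP : ∀ a b, lt a b → P a → P b) (hs : P (s ρ)) {a : Fin (N 2 n)}
    (ha : σ a ∈ Sub 2 (2 * w + l + 1)) (hPa : P a) : TwoIn τ (2 * w + ρ + 1) P := by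
  obtain ⟨b, hb, hab⟩ := O.exists_far h ha
  have hb' : τ b ∈ Sub 2 (2 * w + ρ + 1) := by
    rcases F.leave le_rfl hb with h' | ⟨-, h'⟩
    · exact h'
    · have := lt_child le_rfl w ρ; omega
  refine ⟨s ρ, b, ?_, ⟨by rw [F.dst]; exact self_mem_Sub _ _, hs⟩, hb', hP _ _ hab hPa⟩
  rintro rfl
  rw [F.src] at hb
  exact notMem_Sub_child le_rfl w ρ hb

/-- For an upward closed `P`, the two chips enter the near subtree at different firings of `w`. At
the second entry the far subtree gets two such chips; later it can lose one only by sending it to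
`w`, and the next firing of `w` that selects this chip restores the pair. -/
lemma Oriented.two_in_near (O : Oriented n lt l ρ) {P : Fin (N 2 n) → Prop}
    (hP : ∀ a b, lt a b → P a → P b) {σ : Config (N 2 n)} {d : ℕ → ℕ} (h : Run 2 n σ d) (w : ℕ)
    (h2 : TwoIn σ (2 * w + l + 1) P) : (∃ c, σ c = w ∧ P c) ∨ TwoIn σ (2 * w + ρ + 1) P := by
  induction h with
  | start =>
    obtain ⟨a, b, -, ⟨h, -⟩, -⟩ := h2
    exact absurd h (zero_notMem_Sub_child le_rfl w l)
  | @step σ τ d v s p hrun F ih =>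
    obtain ⟨a, b, hab, ⟨ha, hPa⟩, hb, hPb⟩ := h2
    have hsρ : P (s l) → P (s ρ) := hP _ _ (O.trans (O.mid F).1 (O.mid F).2)
    rcases F.enter le_rfl ha with ha' | ⟨i, rfl, hi⟩
    · rcases F.enter le_rfl hb with hb' | ⟨i, rfl, hi⟩
      · rcases ih ⟨a, b, hab, ⟨ha', hPa⟩, hb', hPb⟩ with ⟨c, hc, hPc⟩ | h2
        · rcases F.stays_or c with hst | ⟨hv, hsel⟩
          · exact Or.inl ⟨c, by rw [hst, hc], hPc⟩
          · have hvw : v = w := by rw [← hv, hc]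
            subst hvw
            refine Or.inr (far_two_of_firing O hrun F hP ?_ ha' hPa)
            rcases O.le_far F hsel with rfl | h'
            · exact hPc
            · exact hP _ _ h' hPc
        · by_cases hv : v = 2 * w + ρ + 1 ∧ P p
          · exact Or.inl ⟨p, by rw [F.dst_p, hv.1, parent_child], hv.2⟩
          · obtain ⟨a, b, hab, ⟨h1, h2⟩, h3, h4⟩ := h2
            have hst : ∀ a, σ a ∈ Sub 2 (2 * w + ρ + 1) → P a → τ a ∈ Sub 2 (2 * w + ρ + 1) := by
              intro a ha hPa
              rcases F.leave le_rfl ha with h' | ⟨rfl, h'⟩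
              · exact h'
              · exact absurd ⟨h', hPa⟩ hv
            exact Or.inr ⟨a, b, hab, ⟨hst a h1 h2, h2⟩, hst b h3 h4, h4⟩
      · obtain ⟨rfl, rfl⟩ := child_inj hi
        exact Or.inr (far_two_of_firing O hrun F hP (hsρ hPb) ha' hPa)
    · obtain ⟨rfl, rfl⟩ := child_inj hi
      rcases F.enter le_rfl hb with hb' | ⟨i, rfl, hi⟩
      · exact Or.inr (far_two_of_firing O hrun F hP (hsρ hPa) hb' hPb)
      · rw [(child_inj hi).2] at hab
        exact absurd rfl hab

/-- The firing of `w` that sends a large chip to the near side sends a larger one to the parent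
`w'`. If `w'` fires it away, a chip with `P` comes back to `w`, its far child, and the next firing
of `w` that selects it puts a second such chip in the far subtree. -/
lemma Oriented.one_in_near (O : Oriented n lt l ρ) {P : Fin (N 2 n) → Prop}
    (hP : ∀ a b, lt a b → P a → P b) {σ : Config (N 2 n)} {d : ℕ → ℕ} (h : Run 2 n σ d)
    {w w' : ℕ} (hw : w = 2 * w' + ρ + 1)
    (h1 : ∃ a, σ a ∈ Sub 2 (2 * w + l + 1) ∧ P a) :
    (∃ c, σ c = w ∧ P c) ∨ (∃ c, σ c = w' ∧ P c) ∨ TwoIn σ (2 * w + ρ + 1) P := by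
  induction h with
  | start =>
    obtain ⟨a, h, -⟩ := h1
    exact absurd h (zero_notMem_Sub_child le_rfl w l)
  | @step σ τ d v s p hrun F ih =>
    obtain ⟨a, ha, hPa⟩ := h1
    rcases F.enter le_rfl ha with ha' | ⟨i, rfl, hi⟩
    · rcases ih ⟨a, ha', hPa⟩ with ⟨c, hc, hPc⟩ | ⟨c, hc, hPc⟩ | h2
      · rcases F.stays_or c with hst | ⟨hv, hsel⟩
        · exact Or.inl ⟨c, by rw [hst, hc], hPc⟩
        · have hvw : v = w := by rw [← hv, hc]
          subst hvw
          refine Or.inr (Or.inr (far_two_of_firing O hrun F hP ?_ ha' hPa))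
          rcases O.le_far F hsel with rfl | h'
          · exact hPc
          · exact hP _ _ h' hPc
      · rcases F.stays_or c with hst | ⟨hv, hsel⟩
        · exact Or.inr (Or.inl ⟨c, by rw [hst, hc], hPc⟩)
        · have hvw : v = w' := by rw [← hv, hc]
          subst hvw
          refine Or.inl ⟨s ρ, by rw [F.dst, hw], ?_⟩
          rcases O.le_far F hsel with rfl | h'
          · exact hPc
          · exact hP _ _ h' hPc
      · by_cases hv : v = 2 * w + ρ + 1 ∧ P p
        · exact Or.inl ⟨p, by rw [F.dst_p, hv.1, parent_child], hv.2⟩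
        · obtain ⟨a, b, hab, ⟨h1, h2⟩, h3, h4⟩ := h2
          have hst : ∀ a, σ a ∈ Sub 2 (2 * w + ρ + 1) → P a → τ a ∈ Sub 2 (2 * w + ρ + 1) := by
            intro a ha hPa
            rcases F.leave le_rfl ha with h' | ⟨rfl, h'⟩
            · exact h'
            · exact absurd ⟨h', hPa⟩ hv
          exact Or.inr (Or.inr ⟨a, b, hab, ⟨hst a h1 h2, h2⟩, hst b h3 h4, h4⟩)
    · obtain ⟨rfl, rfl⟩ := child_inj hi
      exact Or.inr (Or.inl ⟨p, by rw [F.dst_p, hw, parent_child], hP _ _ (O.mid F).1 hPa⟩)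

end

lemma Good.parent_le {k n : ℕ} {σ : Config (N k n)} {d : ℕ → ℕ} (G : Good k n σ d) {w : ℕ}
    {i : Fin k} (h : d (k * w + i + 1) < height k n (k * w + i + 1)) :
    d w ≤ d (k * w + i + 1) + 1 := by
  by_contra hcon
  have := G.le_child w i (d (k * w + i + 1) + 1) h (by omega)
  omega

lemma Good.child_lt {k n : ℕ} (hk : 2 ≤ k) {σ : Config (N k n)} {d : ℕ → ℕ} (G : Good k n σ d)
    {w : ℕ} (h : d w + 1 < height k n w) (i : Fin k) :
    d (k * w + i + 1) < height k n (k * w + i + 1) := by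
  by_contra hcon
  have := G.le_parent w i _ le_rfl (by omega)
  rw [height_child hk] at this
  omega

section

variable {n : ℕ} {lt : Fin (N 2 n) → Fin (N 2 n) → Prop} {l ρ : Fin 2}

lemma far_stay {σ τ : Config (N 2 n)} {u v : ℕ} {s p} (F : Firing 2 σ τ v s p) (hv : v ≠ u)
    {a : Fin (N 2 n)} (ha : σ a ∈ Sub 2 u) : τ a ∈ Sub 2 u := by
  rcases F.leave le_rfl ha with h | ⟨-, h⟩
  · exact h
  · exact absurd h hv

/-- The largest chip of the subtree of `w` is in the subtree of the far child of `w`. -/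
lemma Oriented.exists_gt_at (O : Oriented n lt l ρ) (hn : 1 ≤ n) {σ : Config (N 2 n)} {d : ℕ → ℕ}
    (h : Run 2 n σ d) :
    (∀ w, d w < height 2 n w → ∀ c, σ c = w → ∃ a, σ a ∈ Sub 2 (2 * w + ρ + 1) ∧ lt c a) ∧
    -- This clause concerns the time between a firing of the near child `w` and the next firing of
    -- `w'`; `q` is the chip `w` sent up. When `w'` fires tightly it selects `q`, so the chip it
    -- sends to `w` is at most `q`.
    (∀ w' w : ℕ, w = 2 * w' + l + 1 → d w < height 2 n w → d w < d w' →
      ∃ q, σ q = w' ∧ ∃ a, σ a ∈ Sub 2 (2 * w + ρ + 1) ∧ lt q a) := by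
  induction h with
  | start =>
    refine ⟨fun w hw => ?_, fun w' w _ hw => ?_⟩ <;>
      exact absurd hw (not_lt.2 (le_firingNumber le_rfl _))
  | @step σ τ d v s p hrun F ih =>
    have G := hrun.good le_rfl hn
    have hpos := G.pos le_rfl F.le_count
    have hmid := O.mid F
    have hself : τ (s ρ) ∈ Sub 2 (2 * v + ρ + 1) := by rw [F.dst]; exact self_mem_Sub _ _
    refine ⟨fun w hw c hc => ?_, fun w' w hww hw hlt => ?_⟩
    · by_cases hvw : v = w
      · subst hvw
        rw [Function.update_self] at hw
        rcases F.cases c with rfl | ⟨i, rfl⟩ | ⟨hcp, hcs, hst⟩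
        · exact ⟨s ρ, hself, hmid.2⟩
        · rw [F.dst] at hc
          have := lt_child le_rfl v i
          omega
        · rw [hst] at hc
          by_cases hd : d v < height 2 n v
          · obtain ⟨a, ha, hca⟩ := ih.1 v hd c hc
            exact ⟨a, far_stay F (lt_child le_rfl v ρ).ne ha, hca⟩
          -- Here `d v` equals the height, so this is the first controlled firing: all chips at `v`
          -- are selected and none stays.
          · have hT := G.tight le_rfl F.le_count (by omega)
            rcases F.eq_of_count hT.2.2.2 hc with h | ⟨i, h⟩
            · exact absurd h hcp
            · exact absurd h.symm (hcs i)
      · rw [Function.update_of_ne (Ne.symm hvw)] at hw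
        rcases F.eq_of_dst hc with ⟨rfl, hpar⟩ | ⟨i, rfl, hch⟩ | hold
        · have h0 : v ≠ 0 := by
            rintro rfl
            rw [parent_zero] at hpar
            exact hvw hpar.symm
          obtain ⟨i, hi⟩ := exists_child le_rfl h0
          rw [← hpar] at hi
          rcases fin_two_cases O.ne i with rfl | rfl
          · obtain ⟨a, ha, hca⟩ := O.exists_far hrun (w := w) (c := c)
              (by rw [F.src_p, hi]; exact self_mem_Sub _ _)
            refine ⟨a, far_stay F ?_ ha, hca⟩
            rw [hi]
            exact fun h => O.ne (child_inj h).2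
          · refine ⟨s i, ?_, hmid.2⟩
            rw [← hi]
            exact F.dst_mem (self_mem_Sub _ _) _
        · have hstay : ∀ {a}, σ a ∈ Sub 2 (2 * w + ρ + 1) → τ a ∈ Sub 2 (2 * w + ρ + 1) :=
            far_stay F (by have := lt_child le_rfl v i; have := lt_child le_rfl w ρ; omega)
          have hle : d v ≤ d w + 1 := by
            rw [hch] at hw ⊢
            exact G.parent_le hw
          have hh : height 2 n w = height 2 n v - 1 := by rw [hch, height_child le_rfl]
          have hT := G.tight le_rfl F.le_count (by omega)
          have hTw := hT.2.2.1 i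
          rw [← hch] at hTw
          rcases fin_two_cases O.ne i with rfl | rfl
          · obtain ⟨q, hq, a, ha, hqa⟩ := ih.2 v w hch hw (by omega)
            refine ⟨a, hstay ha, ?_⟩
            rcases O.near_le F (F.eq_of_count hT.2.2.2 hq) with rfl | h
            · exact hqa
            · exact O.trans h hqa
          · obtain ⟨a, ha, hca⟩ := ih.1 v (by omega) (s i) (F.src i)
            -- The larger chip lies somewhere below `w`. If it is not yet in the far subtree of `w`,
            -- one more comparison moves to a larger chip there.
            rw [← hch] at ha
            rcases O.mem_Sub_iff.1 ha with h | h | h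
            · obtain ⟨b, hb, hab⟩ := ih.1 w hw a h
              exact ⟨b, hstay hb, O.trans hca hab⟩
            · obtain ⟨b, hb, hab⟩ := O.exists_far hrun h
              exact ⟨b, hstay hb, O.trans hca hab⟩
            · exact ⟨a, hstay h, hca⟩
        · obtain ⟨a, ha, hca⟩ := ih.1 w hw c hold
          rcases F.leave le_rfl ha with h | ⟨rfl, hv⟩
          · exact ⟨a, h, hca⟩
          · exact ⟨s ρ, F.dst_mem (hv ▸ self_mem_Sub _ _) _, O.trans hca hmid.2⟩
    · by_cases hvw : v = w
      · subst hvw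
        exact ⟨p, by rw [F.dst_p, hww, parent_child], s ρ, hself, hmid.2⟩
      · rw [Function.update_of_ne (Ne.symm hvw)] at hw hlt
        by_cases hvw' : v = w'
        · subst hvw'
          rw [Function.update_self] at hlt
          have hle : d v ≤ d w + 1 := by
            rw [hww] at hw ⊢
            exact G.parent_le hw
          omega
        · rw [Function.update_of_ne (Ne.symm hvw')] at hlt
          obtain ⟨q, hq, a, ha, hqa⟩ := ih.2 w' w hww hw hlt
          refine ⟨q, by rw [F.stays (by rw [hq]; exact Ne.symm hvw'), hq], ?_⟩
          rcases F.leave le_rfl ha with h | ⟨rfl, hv⟩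
          · exact ⟨a, h, hqa⟩
          · exact ⟨s ρ, F.dst_mem (hv ▸ self_mem_Sub _ _) _, O.trans hqa hmid.2⟩

/-- When `x` fires in its controlled rounds, its far chip and another chip of the subtree of `x`
exceed the chip sent to the parent. -/
lemma two_of_firing_far (O : Oriented n lt l ρ) (hn : 1 ≤ n) {σ τ : Config (N 2 n)} {d : ℕ → ℕ}
    (h : Run 2 n σ d) {v : ℕ} {s p} (F : Firing 2 σ τ v s p) (hd : d v < height 2 n v) :
    TwoIn τ v (lt p) ∧ TwoIn τ (2 * v + ρ + 1) (lt p) := by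
  obtain ⟨a, ha, hsa⟩ := (O.exists_gt_at hn h).1 v hd (s ρ) (F.src ρ)
  have ha' := far_stay F (lt_child le_rfl v ρ).ne ha
  have key : TwoIn τ (2 * v + ρ + 1) (lt p) :=
    ⟨s ρ, a, fun h => O.irrefl _ (h ▸ hsa), ⟨by rw [F.dst]; exact self_mem_Sub _ _, (O.mid F).2⟩,
      ha', O.trans (O.mid F).2 hsa⟩
  refine ⟨?_, key⟩
  obtain ⟨a, b, hab, ⟨h1, h2⟩, h3, h4⟩ := key
  exact ⟨a, b, hab, ⟨O.mem_Sub_iff.2 (Or.inr (Or.inr h1)), h2⟩,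
    O.mem_Sub_iff.2 (Or.inr (Or.inr h3)), h4⟩

/-- The induction of `Oriented.exists_gt_at` is repeated one round later, so that the first
statement is available at the children whenever they fire. Two witnesses are needed to place the
root chip relative to the middle of three chips. -/
lemma Oriented.exists_two_gt_at (O : Oriented n lt l ρ) (hn : 1 ≤ n) {σ : Config (N 2 n)}
    {d : ℕ → ℕ} (h : Run 2 n σ d) :
    (∀ w, d w + 1 < height 2 n w → ∀ c, σ c = w → TwoIn σ (2 * w + ρ + 1) (lt c)) ∧
    (∀ w' w : ℕ, w = 2 * w' + l + 1 → d w + 1 < height 2 n w → d w < d w' →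
      ∃ q, σ q = w' ∧ TwoIn σ (2 * w + ρ + 1) (lt q)) := by
  induction h with
  | start =>
    refine ⟨fun w hw => ?_, fun w' w _ hw => ?_⟩ <;>
      exact absurd ((Nat.lt_succ_self _).trans hw) (not_lt.2 (le_firingNumber le_rfl _))
  | @step σ τ d v s p hrun F ih =>
    have G := hrun.good le_rfl hn
    have hpos := G.pos le_rfl F.le_count
    have hmid := O.mid F
    -- The far subtree loses a large chip only when its root fires it upwards; that same firing
    -- leaves two larger chips behind.
    have hpers : ∀ w, d w + 1 < height 2 n w → ∀ c, TwoIn σ (2 * w + ρ + 1) (lt c) →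
        TwoIn τ (2 * w + ρ + 1) (lt c) := by
      intro w hw c h2
      by_cases hv : v = 2 * w + ρ + 1 ∧ lt c p
      · have hd : d v < height 2 n v := by rw [hv.1]; exact G.child_lt le_rfl hw ρ
        have := (two_of_firing_far O hn hrun F hd).1
        rw [hv.1] at this
        exact this.mono fun a _ ha => O.trans hv.2 ha
      · obtain ⟨a, b, hab, ⟨h1, h2⟩, h3, h4⟩ := h2
        have hst : ∀ a, σ a ∈ Sub 2 (2 * w + ρ + 1) → lt c a → τ a ∈ Sub 2 (2 * w + ρ + 1) := by
          intro a ha hca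
          rcases F.leave le_rfl ha with h' | ⟨rfl, h'⟩
          · exact h'
          · exact absurd ⟨h', hca⟩ hv
        exact ⟨a, b, hab, ⟨hst a h1 h2, h2⟩, hst b h3 h4, h4⟩
    refine ⟨fun w hw c hc => ?_, fun w' w hww hw hlt => ?_⟩
    · by_cases hvw : v = w
      · subst hvw
        rw [Function.update_self] at hw
        rcases F.cases c with rfl | ⟨i, rfl⟩ | ⟨hcp, hcs, hst⟩
        · exact (two_of_firing_far O hn hrun F (by omega)).2
        · rw [F.dst] at hc
          have := lt_child le_rfl v i
          omega
        · rw [hst] at hc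
          by_cases hd : d v + 1 < height 2 n v
          · exact hpers v hd c (ih.1 v hd c hc)
          · have hT := G.tight le_rfl F.le_count (by omega)
            rcases F.eq_of_count hT.2.2.2 hc with h | ⟨i, h⟩
            · exact absurd h hcp
            · exact absurd h.symm (hcs i)
      · rw [Function.update_of_ne (Ne.symm hvw)] at hw
        rcases F.eq_of_dst hc with ⟨rfl, hpar⟩ | ⟨i, rfl, hch⟩ | hold
        · have h0 : v ≠ 0 := by
            rintro rfl
            rw [parent_zero] at hpar
            exact hvw hpar.symm
          obtain ⟨i, hi⟩ := exists_child le_rfl h0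
          rw [← hpar] at hi
          have hd : d v < height 2 n v := by rw [hi]; exact G.child_lt le_rfl hw i
          rcases fin_two_cases O.ne i with rfl | rfl
          · have hvρ : v ≠ 2 * w + ρ + 1 := by
              rw [hi]
              exact fun h => O.ne (child_inj h).2
            -- Just before the firing, `c` and `s ρ` are two chips of the near subtree that are at
            -- least `c`.
            have hnear : TwoIn σ (2 * w + i + 1) (fun z => z = c ∨ lt c z) := by
              rw [← hi]
              exact ⟨c, s ρ, (F.ne ρ).symm, ⟨by rw [F.src_p]; exact self_mem_Sub _ _, Or.inl rfl⟩,
                by rw [F.src]; exact self_mem_Sub _ _, Or.inr hmid.2⟩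
            refine hpers w hw c ?_
            rcases O.two_in_near (P := fun z => z = c ∨ lt c z) (fun a b hab h => Or.inr (by
                rcases h with rfl | h
                · exact hab
                · exact O.trans h hab)) hrun w hnear with ⟨c0, hc0, rfl | h⟩ | h2
            · rw [F.src_p] at hc0; exact absurd hc0 hvw
            · exact (ih.1 w hw c0 hc0).mono fun a _ ha => O.trans h ha
            · refine h2.mono fun a ha h => ?_
              rcases h with rfl | h
              · rw [F.src_p, hi] at ha
                exact absurd (Sub_child_disjoint le_rfl (self_mem_Sub _ _) ha) O.ne
              · exact h
          · have := (two_of_firing_far O hn hrun F hd).1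
            rwa [hi] at this
        · have hle : d v ≤ d w + 1 := by
            rw [hch] at hw ⊢
            exact G.parent_le (by omega)
          have hh : height 2 n w = height 2 n v - 1 := by rw [hch, height_child le_rfl]
          have hT := G.tight le_rfl F.le_count (by omega)
          have hTw := hT.2.2.1 i
          rw [← hch] at hTw
          refine hpers w hw _ ?_
          rcases fin_two_cases O.ne i with rfl | rfl
          · obtain ⟨q, hq, h2⟩ := ih.2 v w hch hw (by omega)
            refine h2.mono fun a _ ha => ?_
            rcases O.near_le F (F.eq_of_count hT.2.2.2 hq) with rfl | h
            · exact ha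
            · exact O.trans h ha
          · have h2 := ih.1 v (by omega) (s i) (F.src i)
            rw [← hch] at h2
            by_cases hw2 : ∃ e, σ e = w ∧ lt (s i) e
            · obtain ⟨e, he, hlt⟩ := hw2
              exact (ih.1 w hw e he).mono fun a _ ha => O.trans hlt ha
            · by_cases hnear : ∃ a, σ a ∈ Sub 2 (2 * w + l + 1) ∧ lt (s i) a
              · rcases O.one_in_near (P := lt (s i)) (fun a b hab h => O.trans h hab) hrun hch hnear
                  with h | ⟨e, he, hlt⟩ | h
                · exact absurd h hw2
                -- A tight firing selects every chip at `v`, and `s i` is the largest of them.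
                · exfalso
                  rcases O.le_far F (F.eq_of_count hT.2.2.2 he) with rfl | h
                  · exact O.irrefl _ hlt
                  · exact O.irrefl _ (O.trans hlt h)
                · exact h
              · obtain ⟨a, b, hab, ⟨h1, h2⟩, h3, h4⟩ := h2
                have hin : ∀ a, σ a ∈ Sub 2 w → lt (s i) a → σ a ∈ Sub 2 (2 * w + i + 1) := by
                  intro a ha hlt
                  rcases O.mem_Sub_iff.1 ha with h | h | h
                  · exact absurd ⟨a, h, hlt⟩ hw2
                  · exact absurd ⟨a, h, hlt⟩ hnear
                  · exact h
                exact ⟨a, b, hab, ⟨hin a h1 h2, h2⟩, hin b h3 h4, h4⟩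
        · exact hpers w hw c (ih.1 w hw c hold)
    · by_cases hvw : v = w
      · subst hvw
        rw [Function.update_self] at hw
        exact ⟨p, by rw [F.dst_p, hww, parent_child],
          (two_of_firing_far O hn hrun F (by omega)).2⟩
      · rw [Function.update_of_ne (Ne.symm hvw)] at hw hlt
        by_cases hvw' : v = w'
        · subst hvw'
          rw [Function.update_self] at hlt
          have hle : d v ≤ d w + 1 := by
            rw [hww] at hw ⊢
            exact G.parent_le (by omega)
          omega
        · rw [Function.update_of_ne (Ne.symm hvw')] at hlt
          obtain ⟨q, hq, h2⟩ := ih.2 w' w hww hw hlt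
          exact ⟨q, by rw [F.stays (by rw [hq]; exact Ne.symm hvw'), hq], hpers w hw q h2⟩

end

/-! ### Block decomposition of an ordering and the recursive bound. -/

/-- The permutation that is ordered like the injective tuple `a`. -/
def standardize {n m : ℕ} (a : Fin n → Fin m) : Equiv.Perm (Fin n) := (Tuple.sort a)⁻¹

lemma strictMono_standardize {n m : ℕ} {a : Fin n → Fin m} (ha : Function.Injective a) :
    StrictMono (a ∘ ⇑(standardize a)⁻¹) := by
  rw [standardize, inv_inv]
  exact (Tuple.monotone_sort a).strictMono_of_injective (ha.comp (Equiv.injective _))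

lemma eq_of_strictMono_comp {n m : ℕ} {a b : Fin n → Fin m} {p q : Equiv.Perm (Fin n)}
    (hp : StrictMono (a ∘ ⇑p⁻¹)) (hq : StrictMono (b ∘ ⇑q⁻¹)) (hr : Set.range a = Set.range b) :
    a ∘ ⇑p⁻¹ = b ∘ ⇑q⁻¹ := by
  refine (hp.range_inj hq).1 ?_
  rw [Set.range_comp, Set.range_comp, Equiv.range_eq_univ, Equiv.range_eq_univ, Set.image_univ,
    Set.image_univ, hr]

lemma standardize_eq {n m : ℕ} {a : Fin n → Fin m} (ha : Function.Injective a)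
    {p : Equiv.Perm (Fin n)} (hp : StrictMono (a ∘ ⇑p⁻¹)) : standardize a = p := by
  have h := eq_of_strictMono_comp (strictMono_standardize ha) hp rfl
  refine inv_injective (Equiv.ext fun i => ha ?_)
  exact congrFun h i

lemma standardize_comp {n m : ℕ} {a : Fin n → Fin m} (ha : Function.Injective a)
    (g : Equiv.Perm (Fin n)) : standardize (a ∘ g) = standardize a * g := by
  refine standardize_eq (ha.comp g.injective) ?_
  have : (a ∘ g) ∘ ⇑(standardize a * g)⁻¹ = a ∘ ⇑(standardize a)⁻¹ := by
    funext i; simp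
  rw [this]
  exact strictMono_standardize ha

section

variable {k l : ℕ}

lemma blockPos_lt (hk : 2 ≤ k) (j : Fin k) {i : ℕ} :
    subVertex k (k * 0 + j + 1) i < N k (l + 1) ↔ i < N k l := by
  rw [lt_N_iff_depth hk, lt_N_iff_depth hk, depth_subVertex hk, depth_child hk, depth_zero]
  omega

/-- The position, in a subtree with `l + 1` layers, of the `i`-th position of its `j`-th child's
subtree. -/
def blockPos (hk : 2 ≤ k) (l : ℕ) (j : Fin k) (i : Fin (N k l)) : Fin (N k (l + 1)) :=
  ⟨subVertex k (k * 0 + j + 1) i, (blockPos_lt hk j).2 i.2⟩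

lemma blockPos_inj {hk : 2 ≤ k} {j j' : Fin k} {i i' : Fin (N k l)}
    (h : blockPos hk l j i = blockPos hk l j' i') : j = j' ∧ i = i' := by
  have h' : subVertex k (k * 0 + j + 1) i = subVertex k (k * 0 + j' + 1) i' := Fin.ext_iff.1 h
  have hj : j = j' := Sub_child_disjoint hk ⟨(i : ℕ), rfl⟩ ⟨(i' : ℕ), h'.symm⟩
  subst hj
  exact ⟨rfl, Fin.ext (subVertex_injective hk _ h')⟩

lemma blockPos_injective (hk : 2 ≤ k) (j : Fin k) : Function.Injective (blockPos hk l j) :=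
  fun _ _ h => (blockPos_inj h).2

/-- The root position and the blocks of positions of the children's subtrees. -/
def blockFun (hk : 2 ≤ k) (l : ℕ) : Option (Fin k × Fin (N k l)) → Fin (N k (l + 1))
  | none => ⟨0, N_pos hk (by omega)⟩
  | some x => blockPos hk l x.1 x.2

lemma blockFun_bijective (hk : 2 ≤ k) (l : ℕ) : Function.Bijective (blockFun hk l) := by
  rw [Fintype.bijective_iff_injective_and_card]
  constructor
  · have h0 : ∀ x : Fin k × Fin (N k l), blockFun hk l none ≠ blockFun hk l (some x) := by
      intro x hx
      have hx' : 0 = subVertex k (k * 0 + x.1 + 1) x.2 := Fin.ext_iff.1 hx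
      exact zero_notMem_Sub_child hk 0 x.1 ⟨x.2, hx'.symm⟩
    rintro (_ | x) (_ | y) h
    · rfl
    · exact absurd h (h0 y)
    · exact absurd h.symm (h0 x)
    · have := blockPos_inj (show blockPos hk l x.1 x.2 = blockPos hk l y.1 y.2 from h)
      rw [Prod.ext this.1 this.2]
  · simp [N_succ hk]

/-- `blockFun` as an equivalence. -/
noncomputable def blockEquiv (hk : 2 ≤ k) (l : ℕ) :
    Option (Fin k × Fin (N k l)) ≃ Fin (N k (l + 1)) :=
  Equiv.ofBijective _ (blockFun_bijective hk l)

/-- The ranks on the `j`-th child's subtree. -/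
def block (hk : 2 ≤ k) (w : Equiv.Perm (Fin (N k (l + 1)))) (j : Fin k) (i : Fin (N k l)) :
    Fin (N k (l + 1)) := w (blockPos hk l j i)

lemma block_injective (hk : 2 ≤ k) (w : Equiv.Perm (Fin (N k (l + 1)))) (j : Fin k) :
    Function.Injective (block hk w j) := w.injective.comp (blockPos_injective hk j)

lemma perm_ext_of_block (hk : 2 ≤ k) {w w' : Equiv.Perm (Fin (N k (l + 1)))}
    (h0 : w ⟨0, N_pos hk (by omega)⟩ = w' ⟨0, N_pos hk (by omega)⟩)
    (h : ∀ j i, block hk w j i = block hk w' j i) : w = w' := by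
  refine Equiv.ext fun x => ?_
  obtain ⟨y, rfl⟩ := (blockFun_bijective hk l).2 x
  rcases y with _ | y
  · exact h0
  · exact h y.1 y.2

/-- What an element of `subtreeOrderings` says about a final run. -/
lemma exists_run_of_mem (hk : 2 ≤ k) (hl : 1 ≤ l) {w : Equiv.Perm (Fin (N k l))}
    (hw : w ∈ subtreeOrderings k l) :
    ∃ (n : ℕ) (σ : Config (N k n)) (d : ℕ → ℕ) (v : ℕ) (f : Fin (N k l) ↪o Fin (N k n)),
      1 ≤ n ∧ Run k n σ d ∧ (∀ x, d x = 0) ∧ σ ∈ stableConfigs k n ∧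
      Set.range f = {c | σ c ∈ Sub k v} ∧ ∀ j, σ (f (w j)) = subVertex k v j := by
  obtain ⟨n, σ, v, hσ, f, hf, hj⟩ := hw
  have hn : 1 ≤ n := by
    by_contra! h
    have h0 : n = 0 := by omega
    subst h0
    exact absurd (f ⟨0, N_pos hk hl⟩).2 (by simp [N_zero])
  obtain ⟨d, hd, -, h0⟩ := exists_final_run hk hn hσ
  exact ⟨n, σ, d, v, f, hn, hd, h0, hσ, hf, hj⟩

lemma exists_index {n : ℕ} {σ : Config (N k n)} {v : ℕ} {w : Equiv.Perm (Fin (N k l))}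
    {f : Fin (N k l) ↪o Fin (N k n)} (hf : Set.range f = {c | σ c ∈ Sub k v})
    (hj : ∀ j, σ (f (w j)) = subVertex k v j) {c : Fin (N k n)} (hc : σ c ∈ Sub k v) :
    ∃ j, c = f (w j) ∧ σ c = subVertex k v j := by
  have : c ∈ Set.range f := by rw [hf]; exact hc
  obtain ⟨x, rfl⟩ := this
  refine ⟨w⁻¹ x, by simp, ?_⟩
  rw [← hj]; simp

lemma subVertex_block (hk : 2 ≤ k) (v : ℕ) (j : Fin k) (i : Fin (N k l)) :
    subVertex k v (blockPos hk l j i) = subVertex k (k * v + j + 1) i := by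
  rw [blockPos, ← subVertex_subVertex hk, subVertex_child, subVertex_at_zero]

lemma exists_block_index (hk : 2 ≤ k) {n : ℕ} {σ : Config (N k n)} {v : ℕ}
    {w : Equiv.Perm (Fin (N k (l + 1)))} {f : Fin (N k (l + 1)) ↪o Fin (N k n)}
    (hf : Set.range f = {c | σ c ∈ Sub k v})
    (hj : ∀ j, σ (f (w j)) = subVertex k v j) {c : Fin (N k n)} {j : Fin k}
    (hc : σ c ∈ Sub k (k * v + j + 1)) : ∃ i, c = f (block hk w j i) := by
  obtain ⟨x, rfl, hx⟩ := exists_index hf hj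
    (mem_Sub_trans hk (child_mem_Sub (self_mem_Sub _ _) j) hc)
  obtain ⟨i, hi⟩ := hc
  have hsub : subVertex k (k * v + j + 1) i = subVertex k v (subVertex k (k * 0 + j + 1) i) := by
    rw [← subVertex_subVertex hk, subVertex_child, subVertex_at_zero]
  rw [hx, hsub] at hi
  have hi' := subVertex_injective hk v hi
  refine ⟨⟨i, (blockPos_lt hk j).1 (hi' ▸ x.2)⟩, ?_⟩
  have : x = blockPos hk l j ⟨i, (blockPos_lt hk j).1 (hi' ▸ x.2)⟩ := Fin.ext hi'.symm
  rw [block, ← this]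

lemma standardize_block_mem (hk : 2 ≤ k) {w : Equiv.Perm (Fin (N k (l + 1)))}
    (hw : w ∈ subtreeOrderings k (l + 1)) (j : Fin k) :
    standardize (block hk w j) ∈ subtreeOrderings k l := by
  obtain ⟨n, σ, d, v, f, -, -, -, hσ, hf, hj⟩ := exists_run_of_mem hk (by omega) hw
  refine ⟨n, σ, k * v + j + 1, hσ,
    (OrderEmbedding.ofStrictMono _ (strictMono_standardize (block_injective hk w j))).trans f, ?_,
    fun i => ?_⟩
  · ext c
    constructor
    · rintro ⟨x, rfl⟩
      refine ⟨((standardize (block hk w j))⁻¹ x : Fin (N k l)), ?_⟩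
      rw [← subVertex_block hk, ← hj]
      rfl
    · intro hc
      obtain ⟨i, rfl⟩ := exists_block_index hk hf hj hc
      exact ⟨standardize (block hk w j) i, by simp⟩
  · rw [← subVertex_block hk, ← hj]
    simp [block]

lemma block_root_strictMono (hk : 2 ≤ k) (hl : 1 ≤ l) {w : Equiv.Perm (Fin (N k (l + 1)))}
    (hw : w ∈ subtreeOrderings k (l + 1)) :
    StrictMono fun j => block hk w j ⟨0, N_pos hk hl⟩ := by
  obtain ⟨n, σ, d, v, f, hn, hd, h0, -, hf, hj⟩ := exists_run_of_mem hk (by omega) hw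
  intro i j hij
  have hroot : ∀ j : Fin k, σ (f (block hk w j ⟨0, N_pos hk hl⟩)) = k * v + j + 1 := fun j => by
    rw [block, hj, subVertex_block, subVertex_at_zero]
  exact f.lt_iff_lt.1 (hd.siblings_sorted hk hn (h0 v) hij (hroot i) (hroot j))

lemma block_exists_lt (hk : 2 ≤ k) {w : Equiv.Perm (Fin (N k (l + 1)))}
    (hw : w ∈ subtreeOrderings k (l + 1)) {i j : Fin k} (hij : i < j) (a : Fin (N k l)) :
    (∃ b, block hk w i b < block hk w j a) ∧ ∃ b, block hk w i a < block hk w j b := by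
  obtain ⟨n, σ, d, v, f, hn, hd, h0, -, hf, hj⟩ := exists_run_of_mem hk (by omega) hw
  have hmem : ∀ j : Fin k, σ (f (block hk w j a)) ∈ Sub k (k * v + j + 1) := fun j =>
    ⟨a, by rw [block, hj, subVertex_block]⟩
  constructor
  · obtain ⟨c, hc, hlt⟩ := hd.exists_lt hk hij (hmem j)
    obtain ⟨b, rfl⟩ := exists_block_index hk hf hj hc
    exact ⟨b, f.lt_iff_lt.1 hlt⟩
  · obtain ⟨c, hc, hlt⟩ := hd.exists_gt hk hij (hmem i)
    obtain ⟨b, rfl⟩ := exists_block_index hk hf hj hc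
    exact ⟨b, f.lt_iff_lt.1 hlt⟩

/-- Permute the blocks by `π` and the positions in each block by `g`. -/
noncomputable def shuffle (hk : 2 ≤ k) (w : Equiv.Perm (Fin (N k (l + 1))))
    (π : Equiv.Perm (Fin k)) (g : Fin k → Equiv.Perm (Fin (N k l))) :
    Equiv.Perm (Fin (N k (l + 1))) :=
  (blockEquiv hk l).symm.trans
    ((Equiv.optionCongr (Equiv.prodShear π g)).trans ((blockEquiv hk l).trans w))

lemma shuffle_root (hk : 2 ≤ k) (w : Equiv.Perm (Fin (N k (l + 1))))
    (π : Equiv.Perm (Fin k)) (g : Fin k → Equiv.Perm (Fin (N k l))) :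
    shuffle hk w π g ⟨0, N_pos hk (by omega)⟩ = w ⟨0, N_pos hk (by omega)⟩ := by
  have : (⟨0, N_pos hk (by omega)⟩ : Fin (N k (l + 1))) = blockEquiv hk l none := rfl
  rw [this]
  simp [shuffle]

lemma block_shuffle (hk : 2 ≤ k) (w : Equiv.Perm (Fin (N k (l + 1))))
    (π : Equiv.Perm (Fin k)) (g : Fin k → Equiv.Perm (Fin (N k l))) (j : Fin k) :
    block hk (shuffle hk w π g) j = block hk w (π j) ∘ g j := by
  funext i
  have : ∀ j i, blockPos hk l j i = blockEquiv hk l (some (j, i)) := fun _ _ => rfl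
  simp [block, this, shuffle]

/-- Sorted siblings: the recursive bound on the number of subtree orderings. -/
theorem T_succ_mul_le (hk : 2 ≤ k) (hl : 1 ≤ l) :
    T k (l + 1) * (k.factorial * (N k l).factorial ^ k) ≤
      (N k (l + 1)).factorial * T k l ^ k := by
  -- The pair determines its preimage: standardizing the blocks of the shuffled permutation gives
  -- `g`, the order of the block roots gives `π`, and undoing both gives `w`.
  let Φ : subtreeOrderings k (l + 1) × Equiv.Perm (Fin k) × (Fin k → Equiv.Perm (Fin (N k l))) →
      Equiv.Perm (Fin (N k (l + 1))) × (Fin k → subtreeOrderings k l) := fun x =>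
    (shuffle hk x.1 x.2.1 x.2.2,
      fun j => ⟨standardize (block hk x.1 (x.2.1 j)), standardize_block_mem hk x.1.2 _⟩)
  have hΦ : Function.Injective Φ := by
    rintro ⟨⟨w, hw⟩, π, g⟩ ⟨⟨w', hw'⟩, π', g'⟩ h
    simp only [Φ, Prod.mk.injEq] at h
    obtain ⟨h1, h2⟩ := h
    have hstd : ∀ j, standardize (block hk w (π j)) = standardize (block hk w' (π' j)) :=
      fun j => congrArg Subtype.val (congrFun h2 j)
    have hcomp : ∀ j, block hk w (π j) ∘ g j = block hk w' (π' j) ∘ g' j := fun j => by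
      rw [← block_shuffle, ← block_shuffle, h1]
    have hg : g = g' := by
      funext j
      have := congrArg standardize (hcomp j)
      rw [standardize_comp (block_injective hk _ _), standardize_comp (block_injective hk _ _),
        hstd j] at this
      exact mul_left_cancel this
    subst hg
    have hblock : ∀ j i, block hk w (π j) i = block hk w' (π' j) i := fun j i => by
      have := congrFun (hcomp j) ((g j)⁻¹ i)
      simpa using this
    have hπ : π = π' := by
      have hm := block_root_strictMono hk hl hw
      have hm' := block_root_strictMono hk hl hw'
      -- Block roots increase from left to right, so standardizing the permuted sequence of root
      -- ranks returns the permutation itself.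
      have heq : (fun j => block hk w j ⟨0, N_pos hk hl⟩) ∘ π =
          (fun j => block hk w' j ⟨0, N_pos hk hl⟩) ∘ π' := funext fun j => hblock j _
      have h1 := standardize_eq (hm.injective.comp π.injective) (p := π) (by
        convert hm using 1; funext i; simp)
      have h2 := standardize_eq (hm'.injective.comp π'.injective) (p := π') (by
        convert hm' using 1; funext i; simp)
      rw [← h1, ← h2, heq]
    subst hπ
    have hww : w = w' := by
      refine perm_ext_of_block hk ?_ fun j i => ?_
      · rw [← shuffle_root hk w π g, ← shuffle_root hk w' π g, h1]
      · have := hblock (π⁻¹ j) i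
        simpa using this
    subst hww
    rfl
  have := Nat.card_le_card_of_injective Φ hΦ
  simpa [Nat.card_prod, Nat.card_perm, Nat.card_pi, T, Nat.card_coe_set_eq, Fintype.card_perm] using this

/-- This makes it unnecessary to show that stable configurations exist: if the larger count is
nonzero, so are the smaller ones. -/
lemma T_pos_of_succ (hk : 2 ≤ k) (h : 0 < T k (l + 1)) : 0 < T k l := by
  obtain ⟨w, hw⟩ := (Set.ncard_pos (Set.toFinite _)).1 h
  exact (Set.ncard_pos (Set.toFinite _)).2 ⟨_, standardize_block_mem hk hw ⟨0, by omega⟩⟩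

lemma T_one_le (hk : 2 ≤ k) : T k 1 ≤ 1 := by
  refine (Set.ncard_le_card _).trans ?_
  simp [N_one hk]

/-- Stable configurations are determined by the ordering of the whole tree. -/
lemma stableConfigs_subset (hk : 2 ≤ k) (hl : 1 ≤ l) :
    stableConfigs k l ⊆ (fun w : Equiv.Perm (Fin (N k l)) => fun c => ((w⁻¹ c : Fin _) : ℕ)) ''
      subtreeOrderings k l := by
  intro σ hσ
  obtain ⟨d, hd, G, h0⟩ := exists_final_run hk hl hσ
  have hcount := G.count_of_zero hk h0
  have hlt : ∀ c, σ c < N k l := by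
    intro c
    by_contra h
    have := hcount (σ c)
    rw [if_neg h] at this
    have hpos : 0 < count σ (σ c) := Finset.card_pos.2 ⟨c, by simp⟩
    omega
  have hinj : Function.Injective fun c => (⟨σ c, hlt c⟩ : Fin (N k l)) := by
    intro a b hab
    have hab' : σ a = σ b := Fin.ext_iff.1 hab
    have := hcount (σ a)
    rw [if_pos (hlt a)] at this
    exact Finset.card_le_one.1 this.le a (by simp) b (by simp [hab'])
  let u : Equiv.Perm (Fin (N k l)) :=
    Equiv.ofBijective _ (Finite.injective_iff_bijective.1 hinj)
  have hu : ∀ c, ((u c : Fin _) : ℕ) = σ c := fun c => rfl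
  refine ⟨u⁻¹, ⟨l, σ, 0, hσ, RelEmbedding.refl _, ?_, fun j => ?_⟩, funext fun c => ?_⟩
  · ext c
    simpa [Sub] using Sub_zero hk (σ c)
  · rw [subVertex_zero hk]
    change σ (u⁻¹ j) = j
    rw [← hu]; simp
  · simp [hu]

lemma stableConfigs_finite (hk : 2 ≤ k) (hl : 1 ≤ l) : (stableConfigs k l).Finite :=
  ((Set.toFinite _).image _).subset (stableConfigs_subset hk hl)

lemma Z_le_T (hk : 2 ≤ k) (hl : 1 ≤ l) : Z k l ≤ T k l :=
  (Set.ncard_le_ncard (stableConfigs_subset hk hl) ((Set.toFinite _).image _)).trans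
    (Set.ncard_image_le (Set.toFinite _))

end

/-! ### Three layers of the binary tree. -/

lemma eq_of_mem_Sub_leaf {u j : ℕ} (hu : 3 ≤ u) (hj : j < 7) (h : j ∈ Sub 2 u) : j = u := by
  rcases (mem_Sub_iff_child le_rfl).1 h with h | ⟨i, h⟩
  · exact h
  · have := le_of_mem_Sub le_rfl h; omega

lemma eq_of_mem_Sub_two {j : ℕ} (hj : j < 7) (h : j ∈ Sub 2 2) : j = 2 ∨ j = 5 ∨ j = 6 := by
  rcases (mem_Sub_iff_child le_rfl).1 h with h | ⟨i, h⟩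
  · exact Or.inl h
  · have := eq_of_mem_Sub_leaf (by omega) hj h; omega

lemma eq_of_mem_Sub_one {j : ℕ} (hj : j < 7) (h : j ∈ Sub 2 1) : j = 1 ∨ j = 3 ∨ j = 4 := by
  rcases (mem_Sub_iff_child le_rfl).1 h with h | ⟨i, h⟩
  · exact Or.inl h
  · have := eq_of_mem_Sub_leaf (by omega) hj h; omega

/-- The order relations in a binary subtree with three layers. -/
structure ThreeLayers (w : Equiv.Perm (Fin 7)) : Prop where
  h31 : w 3 < w 1
  h14 : w 1 < w 4
  h52 : w 5 < w 2
  h26 : w 2 < w 6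
  h10 : w 1 < w 0
  h02 : w 0 < w 2
  h35 : w 3 < w 5
  h46 : w 4 < w 6

lemma threeLayers_of_mem {w : Equiv.Perm (Fin (N 2 3))} (hw : w ∈ subtreeOrderings 2 3) :
    ThreeLayers (w : Equiv.Perm (Fin 7)) := by
  obtain ⟨n, σ, d, v, f, hn, hrun, h0, hσ, hf, hj⟩ := exists_run_of_mem le_rfl (by omega) hw
  let w' : Equiv.Perm (Fin 7) := w
  let g : Fin 7 ↪o Fin (N 2 n) := f
  have hg : ∀ j : Fin 7, σ (g (w' j)) = subVertex 2 v j := hj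
  have G := hrun.good le_rfl hn
  have hindex : ∀ {c : Fin (N 2 n)} {a : ℕ} {i : Fin 2},
      σ c ∈ Sub 2 (2 * subVertex 2 v a + i + 1) →
      ∃ j : Fin 7, c = g (w' j) ∧ (j : ℕ) ∈ Sub 2 (2 * a + i + 1) := by
    intro c a i hc
    rw [← subVertex_child] at hc
    obtain ⟨j, hcj, hsj⟩ := exists_index hf hj (mem_Sub_trans le_rfl ⟨_, rfl⟩ hc)
    refine ⟨j, hcj, ?_⟩
    obtain ⟨b, hb⟩ := hc
    rw [subVertex_subVertex le_rfl, hsj] at hb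
    exact ⟨b, subVertex_injective le_rfl v hb⟩
  -- Vertex 3 of the subtree carries a chip, and final chips occupy only the first `n` layers. Thus
  -- the subtree root has height at least 2, as the two-chip lemma requires.
  have hheight : depth 2 v + 2 < n := by
    have hc := G.count_of_zero le_rfl h0 (subVertex 2 v 3)
    have hpos : 0 < count σ (subVertex 2 v 3) :=
      Finset.card_pos.2 ⟨g (w' 3), by simpa using hg 3⟩
    have hlt : subVertex 2 v 3 < N 2 n := by
      by_contra h
      rw [if_neg h] at hc
      omega
    rw [lt_N_iff_depth le_rfl, depth_subVertex le_rfl] at hlt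
    have h3 : depth 2 3 = 2 := by
      have h1 := depth_child le_rfl 1 (0 : Fin 2)
      have h2 := depth_child le_rfl 0 (0 : Fin 2)
      rw [depth_zero] at h2
      norm_num at h1 h2
      rw [h1, h2]
    omega
  have hd0 := depth_zero 2
  have hd1 : depth 2 1 = 1 := by simpa [depth_zero] using depth_child le_rfl 0 (0 : Fin 2)
  have hd2 : depth 2 2 = 1 := by simpa [depth_zero] using depth_child le_rfl 0 (1 : Fin 2)
  have hlt : ∀ j : Fin 7, depth 2 (j : ℕ) ≤ 1 → d (subVertex 2 v j) <
      height 2 n (subVertex 2 v j) := by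
    intro j hj
    rw [h0, height, depth_subVertex le_rfl]
    omega
  have up : ∀ a : Fin 7, depth 2 (a : ℕ) ≤ 1 →
      ∃ j : Fin 7, (j : ℕ) ∈ Sub 2 (2 * a + 2) ∧ w' a < w' j := by
    intro a ha
    obtain ⟨c, hc, hlt⟩ := ((oriented_lt n).exists_gt_at hn hrun).1 _ (hlt a ha) _ (hg a)
    obtain ⟨j, rfl, hj⟩ := hindex hc
    exact ⟨j, hj, g.lt_iff_lt.1 hlt⟩
  have down : ∀ a : Fin 7, depth 2 (a : ℕ) ≤ 1 →
      ∃ j : Fin 7, (j : ℕ) ∈ Sub 2 (2 * a + 1) ∧ w' j < w' a := by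
    intro a ha
    obtain ⟨c, hc, hlt⟩ := ((oriented_gt n).exists_gt_at hn hrun).1 _ (hlt a ha) _ (hg a)
    obtain ⟨j, rfl, hj⟩ := hindex hc
    exact ⟨j, hj, g.lt_iff_lt.1 hlt⟩
  have hv : σ (g (w' 0)) = v := by rw [hg]; exact subVertex_at_zero 2 v
  have hv2 : d v + 1 < height 2 n v := by rw [h0, height]; omega
  have h14 : w' 1 < w' 4 := by
    obtain ⟨j, hj, h⟩ := up 1 hd1.le
    have := eq_of_mem_Sub_leaf (by decide) j.2 hj
    rwa [show j = 4 from Fin.ext this] at h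
  have h31 : w' 3 < w' 1 := by
    obtain ⟨j, hj, h⟩ := down 1 hd1.le
    have := eq_of_mem_Sub_leaf (by decide) j.2 hj
    rwa [show j = 3 from Fin.ext this] at h
  have h26 : w' 2 < w' 6 := by
    obtain ⟨j, hj, h⟩ := up 2 hd2.le
    have := eq_of_mem_Sub_leaf (by decide) j.2 hj
    rwa [show j = 6 from Fin.ext this] at h
  have h52 : w' 5 < w' 2 := by
    obtain ⟨j, hj, h⟩ := down 2 hd2.le
    have := eq_of_mem_Sub_leaf (by decide) j.2 hj
    rwa [show j = 5 from Fin.ext this] at h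
  -- Two of the positions 2, 5, 6 exceed the root, and position 2 holds the middle value of the
  -- three.
  have h02 : w' 0 < w' 2 := by
    obtain ⟨a, b, hab, ⟨ha, hla⟩, hb, hlb⟩ :=
      ((oriented_lt n).exists_two_gt_at hn hrun).1 v hv2 _ hv
    rw [← subVertex_at_zero 2 v] at ha hb
    obtain ⟨i, rfl, hi⟩ := hindex ha
    obtain ⟨j, rfl, hj⟩ := hindex hb
    have hla := g.lt_iff_lt.1 hla
    have hlb := g.lt_iff_lt.1 hlb
    have hij : i ≠ j := fun h => hab (by rw [h])
    rcases eq_of_mem_Sub_two i.2 hi with h | h | h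
    · rwa [show i = 2 from Fin.ext h] at hla
    · rw [show i = 5 from Fin.ext h] at hla; exact hla.trans h52
    · rcases eq_of_mem_Sub_two j.2 hj with h' | h' | h'
      · rwa [show j = 2 from Fin.ext h'] at hlb
      · rw [show j = 5 from Fin.ext h'] at hlb; exact hlb.trans h52
      · exact absurd (Fin.ext (h.trans h'.symm)) hij
  have h10 : w' 1 < w' 0 := by
    obtain ⟨a, b, hab, ⟨ha, hla⟩, hb, hlb⟩ :=
      ((oriented_gt n).exists_two_gt_at hn hrun).1 v hv2 _ hv
    rw [← subVertex_at_zero 2 v] at ha hb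
    obtain ⟨i, rfl, hi⟩ := hindex ha
    obtain ⟨j, rfl, hj⟩ := hindex hb
    have hla := g.lt_iff_lt.1 hla
    have hlb := g.lt_iff_lt.1 hlb
    have hij : i ≠ j := fun h => hab (by rw [h])
    rcases eq_of_mem_Sub_one i.2 hi with h | h | h
    · rwa [show i = 1 from Fin.ext h] at hla
    · rcases eq_of_mem_Sub_one j.2 hj with h' | h' | h'
      · rwa [show j = 1 from Fin.ext h'] at hlb
      · exact absurd (Fin.ext (h.trans h'.symm)) hij
      · rw [show j = 4 from Fin.ext h'] at hlb; exact h14.trans hlb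
    · rw [show i = 4 from Fin.ext h] at hla; exact h14.trans hla
  refine ⟨h31, h14, h52, h26, h10, h02, ?_, ?_⟩
  -- Something in the left subtree is below position 5, hence so is position 3, the minimum there.
  -- The last goal is the mirror image.
  · obtain ⟨c, hc, hlt⟩ := hrun.exists_lt le_rfl (show (0 : Fin 2) < 1 by decide)
      (w := subVertex 2 v 0) (c := g (w' 5)) (by
        rw [hg, ← subVertex_child]
        refine ⟨1, ?_⟩
        rw [subVertex_subVertex le_rfl]
        simpa [subVertex_at_zero] using
          congrArg (subVertex 2 v) (subVertex_child (k := 2) 2 0 (0 : Fin 2)))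
    obtain ⟨j, rfl, hj⟩ := hindex hc
    have hlt := g.lt_iff_lt.1 hlt
    rcases eq_of_mem_Sub_one j.2 hj with h | h | h
    · rw [show j = 1 from Fin.ext h] at hlt; exact h31.trans hlt
    · rwa [show j = 3 from Fin.ext h] at hlt
    · rw [show j = 4 from Fin.ext h] at hlt; exact h31.trans (h14.trans hlt)
  · obtain ⟨c, hc, hlt⟩ := hrun.exists_gt le_rfl (show (0 : Fin 2) < 1 by decide)
      (w := subVertex 2 v 0) (c := g (w' 4)) (by
        rw [hg, ← subVertex_child]
        refine ⟨2, ?_⟩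
        rw [subVertex_subVertex le_rfl]
        simpa [subVertex_at_zero] using
          congrArg (subVertex 2 v) (subVertex_child (k := 2) 1 0 (1 : Fin 2)))
    obtain ⟨j, rfl, hj⟩ := hindex hc
    have hlt := g.lt_iff_lt.1 hlt
    rcases eq_of_mem_Sub_two j.2 hj with h | h | h
    · rw [show j = 2 from Fin.ext h] at hlt; exact hlt.trans h26
    · rw [show j = 5 from Fin.ext h] at hlt; exact hlt.trans (h52.trans h26)
    · rwa [show j = 6 from Fin.ext h] at hlt

lemma ThreeLayers.bounds {w : Equiv.Perm (Fin 7)} (h : ThreeLayers w) :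
    w 3 = 0 ∧ w 6 = 6 ∧ StrictMono ![w 1, w 0, w 2] := by
  obtain ⟨h31, h14, h52, h26, h10, h02, h35, h46⟩ := h
  have hlow : ∀ x, w 3 ≤ w x := by
    intro x; fin_cases x <;> simp <;> order
  have hupp : ∀ x, w x ≤ w 6 := by
    intro x; fin_cases x <;> simp <;> order
  refine ⟨?_, ?_, ?_⟩
  · have := hlow (w⁻¹ 0)
    simpa using this
  · have := hupp (w⁻¹ 6)
    rw [← Equiv.Perm.mul_apply, mul_inv_cancel, Equiv.Perm.one_apply] at this
    exact le_antisymm (Fin.le_last _) this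
  · intro i j hij
    fin_cases i <;> fin_cases j <;> simp at hij ⊢ <;> order

/-- The extreme ranks are at positions 3 and 6, and positions 1, 0, 2 increase. So the distinct
ranks at positions 4 and 5, among five possible values, determine everything: `5 * 4 = 20`. -/
lemma ncard_threeLayers_le : {w : Equiv.Perm (Fin 7) | ThreeLayers w}.ncard ≤ 20 := by
  let S : Finset (Fin 7 × Fin 7) := Finset.univ.filter fun x =>
    x.1 ≠ x.2 ∧ x.1 ≠ 0 ∧ x.1 ≠ 6 ∧ x.2 ≠ 0 ∧ x.2 ≠ 6
  have hS : S.card = 20 := by decide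
  rw [← hS, ← Set.ncard_coe_finset]
  refine Set.ncard_le_ncard_of_injOn (fun w => (w 4, w 5)) ?_ ?_
  · intro w hw
    obtain ⟨h3, h6, -⟩ := ThreeLayers.bounds hw
    simp only [S, Finset.coe_filter, Finset.mem_univ, true_and, Set.mem_ofPred_eq]
    rw [← h6, ← h3]
    simp [w.injective.eq_iff]
  · intro w hw w' hw' h
    obtain ⟨h3, h6, hm⟩ := ThreeLayers.bounds hw
    obtain ⟨h3', h6', hm'⟩ := ThreeLayers.bounds hw'
    simp only [Prod.mk.injEq] at h
    have hr : ∀ w : Equiv.Perm (Fin 7), Set.range ![w 1, w 0, w 2] =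
        {x | x ≠ w 3 ∧ x ≠ w 4 ∧ x ≠ w 5 ∧ x ≠ w 6} := by
      intro w
      ext x
      obtain ⟨y, rfl⟩ := w.surjective x
      simp only [Set.mem_range, Fin.exists_fin_succ, Set.mem_ofPred_eq, ne_eq,
        w.injective.eq_iff]
      fin_cases y <;> simp
    have heq := (hm.range_inj hm').1 (by rw [hr, hr, h3, h6, h.1, h.2, h3', h6'])
    have e1 : w 1 = w' 1 := congrFun heq 0
    have e0 : w 0 = w' 0 := congrFun heq 1
    have e2 : w 2 = w' 2 := congrFun heq 2
    refine Equiv.ext fun x => ?_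
    fin_cases x
    · exact e0
    · exact e1
    · exact e2
    · exact h3.trans h3'.symm
    · exact h.1
    · exact h.2
    · exact h6.trans h6'.symm

lemma T_two_three_le : T 2 3 ≤ 20 :=
  (Set.ncard_le_ncard (t := {w : Equiv.Perm (Fin 7) | ThreeLayers w})
    (fun _ hw => threeLayers_of_mem hw) (Set.toFinite _)).trans ncard_threeLayers_le

/-! ### Zigzag numbers -/

/-- The alternating permutations counted by `eulerZigzag`. -/
def Alternating {n : ℕ} (π : Equiv.Perm (Fin n)) : Prop :=
  ∀ i j : Fin n, (i : ℕ) + 1 = j → if Even (i : ℕ) then π i < π j else π j < π i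

instance {n : ℕ} (π : Equiv.Perm (Fin n)) : Decidable (Alternating π) := by
  unfold Alternating; infer_instance

/-- The permutation with last value `v` whose other values are ordered like `τ`. -/
def appendValue {n : ℕ} (τ : Equiv.Perm (Fin n)) (v : Fin (n + 1)) : Equiv.Perm (Fin (n + 1)) :=
  finSuccEquivLast.trans ((Equiv.optionCongr τ).trans (finSuccEquiv' v).symm)

lemma appendValue_last {n : ℕ} (τ : Equiv.Perm (Fin n)) (v : Fin (n + 1)) :
    appendValue τ v (Fin.last n) = v := by
  simp [appendValue]

lemma appendValue_castSucc {n : ℕ} (τ : Equiv.Perm (Fin n)) (v : Fin (n + 1)) (i : Fin n) :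
    appendValue τ v i.castSucc = v.succAbove (τ i) := by
  simp [appendValue]

lemma appendValue_bijective (n : ℕ) :
    Function.Bijective fun x : Equiv.Perm (Fin n) × Fin (n + 1) => appendValue x.1 x.2 := by
  rw [Fintype.bijective_iff_injective_and_card]
  constructor
  · rintro ⟨τ, v⟩ ⟨τ', v'⟩ h
    simp only at h
    have hv : v = v' := by rw [← appendValue_last τ v, h, appendValue_last]
    subst hv
    have hτ : τ = τ' := by
      refine Equiv.ext fun i => ?_
      have := congrArg (fun e : Equiv.Perm (Fin (n + 1)) => e i.castSucc) h
      simp only [appendValue_castSucc] at this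
      exact Fin.succAbove_right_injective this
    rw [hτ]
  · simp [Fintype.card_perm, Nat.factorial_succ, mul_comm]

/-- The condition on the value `v` appended to an alternating permutation of `m + 1` elements with
last value `s`. -/
def CanAppend (m s v : ℕ) : Prop := if Even m then s < v else v ≤ s

instance (m s v : ℕ) : Decidable (CanAppend m s v) := by unfold CanAppend; infer_instance

/-- Inserting `v` shifts old values that are at least `v` up by one. Hence a descent to `v` means `v
≤ s`, not `v < s`. -/
lemma alternating_appendValue {m : ℕ} (τ : Equiv.Perm (Fin (m + 1))) (v : Fin (m + 2)) :
    Alternating (appendValue τ v) ↔ Alternating τ ∧ CanAppend m (τ (Fin.last m)) v := by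
  have hlast : (if Even m then appendValue τ v (Fin.last m).castSucc <
      appendValue τ v (Fin.last (m + 1)) else appendValue τ v (Fin.last (m + 1)) <
      appendValue τ v (Fin.last m).castSucc) ↔ CanAppend m (τ (Fin.last m)) v := by
    rw [appendValue_last, appendValue_castSucc, CanAppend, Fin.succAbove_lt_iff_castSucc_lt,
      Fin.lt_succAbove_iff_le_castSucc]
    rfl
  have hinit : ∀ i j : Fin (m + 1), (if Even (i : ℕ) then
      appendValue τ v i.castSucc < appendValue τ v j.castSucc else
      appendValue τ v j.castSucc < appendValue τ v i.castSucc) ↔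
      if Even (i : ℕ) then τ i < τ j else τ j < τ i := by
    intro i j
    simp only [appendValue_castSucc, Fin.succAbove_lt_succAbove_iff]
  constructor
  · intro h
    refine ⟨fun i j hij => (hinit i j).1 (h i.castSucc j.castSucc (by simpa using hij)), ?_⟩
    have := h (Fin.last m).castSucc (Fin.last (m + 1)) (by simp)
    rw [← hlast]
    simpa using this
  · rintro ⟨h1, h2⟩ i j hij
    induction i using Fin.lastCases with
    | last => have := j.2; simp at hij; omega
    | cast i =>
      induction j using Fin.lastCases with
      | last =>
        have hi : i = Fin.last m := Fin.ext (by simpa using hij)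
        subst hi
        rw [← hlast] at h2
        simpa using h2
      | cast j => exact (hinit i j).2 (h1 i j (by simpa using hij))

/-- The weight `g` on the last value allows the extension to be iterated: extending twice takes the
number of admissible next values as weight. -/
lemma sum_alternating_succ (m : ℕ) (g : ℕ → ℕ) :
    ∑ π : Equiv.Perm (Fin (m + 2)), (if Alternating π then g (π (Fin.last (m + 1))) else 0) =
      ∑ τ : Equiv.Perm (Fin (m + 1)), if Alternating τ then
        ∑ v ∈ Finset.range (m + 2), (if CanAppend m (τ (Fin.last m)) v then g v else 0) else 0 := by
  rw [← (appendValue_bijective (m + 1)).sum_comp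
    (fun π => if Alternating π then g (π (Fin.last (m + 1))) else 0), Fintype.sum_prod_type]
  refine Finset.sum_congr rfl fun τ _ => ?_
  simp only [alternating_appendValue, appendValue_last]
  by_cases h : Alternating τ
  · simp only [h, true_and, if_true]
    exact Fin.sum_univ_eq_sum_range
      (fun v => if CanAppend m (τ (Fin.last m)) v then g v else 0) (m + 2)
  · simp [h]

lemma eulerZigzag_eq_sum (n : ℕ) :
    eulerZigzag n = ∑ π : Equiv.Perm (Fin n), if Alternating π then 1 else 0 := by
  rw [eulerZigzag, Finset.card_filter]
  rfl

lemma sum_canAppend_of_even {m s : ℕ} (hm : Even m) :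
    ∑ v ∈ Finset.range (m + 2), (if CanAppend m s v then 1 else 0) = m + 1 - s := by
  have : (Finset.range (m + 2)).filter (fun v => CanAppend m s v) = Finset.Ioc s (m + 1) := by
    ext v
    simp only [CanAppend, hm, if_true, Finset.mem_filter, Finset.mem_range, Finset.mem_Ioc]
    omega
  rw [← Finset.card_filter, this, Nat.card_Ioc]

lemma sum_canAppend_of_odd {m s : ℕ} (hm : ¬ Even m) (hs : s ≤ m + 1) :
    ∑ v ∈ Finset.range (m + 2), (if CanAppend m s v then 1 else 0) = s + 1 := by
  have : (Finset.range (m + 2)).filter (fun v => CanAppend m s v) = Finset.range (s + 1) := by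
    ext v
    simp only [CanAppend, hm, if_false, Finset.mem_filter, Finset.mem_range]
    omega
  rw [← Finset.card_filter, this, Finset.card_range]

/-- The values `v + 1` for `s < v < M` fill the top of an interval, so their mean is at least `(M +
1) / 2`. -/
lemma le_sum_of_even (s M : ℕ) :
    (M + 1) * (M - 1 - s) ≤ ∑ v ∈ Finset.range M, if s < v then 2 * (v + 1) else 0 := by
  induction M with
  | zero => simp
  | succ M ih =>
    rw [Finset.sum_range_succ]
    by_cases h : s < M
    · obtain ⟨t, rfl⟩ := Nat.exists_eq_add_of_lt h
      rw [if_pos h]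
      have e1 : s + t + 1 - 1 - s = t := by omega
      have e2 : s + t + 1 + 1 - 1 - s = t + 1 := by omega
      rw [e1] at ih
      rw [e2]
      nlinarith
    · rw [if_neg h]
      have : M + 1 - 1 - s = 0 := by omega
      rw [this]; simp

/-- The `t` largest numbers of `1, …, M` have mean at least `(M + 1) / 2`. -/
lemma le_sum_of_odd {t M : ℕ} (h : t ≤ M) :
    t * (M + 1) ≤ ∑ v ∈ Finset.range t, 2 * (M - v) := by
  have key : ∀ t ≤ M, t * (2 * M + 1) = ∑ v ∈ Finset.range t, 2 * (M - v) + t * t := by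
    intro t
    induction t with
    | zero => simp
    | succ t ih =>
      intro ht
      rw [Finset.sum_range_succ]
      have := ih (by omega)
      obtain ⟨r, rfl⟩ := Nat.exists_eq_add_of_lt ht
      have e : t + r + 1 - t = r + 1 := by omega
      rw [e]
      nlinarith
  have := key t h
  nlinarith

/-- The zigzag numbers grow by at least half the trivial factor. -/
lemma eulerZigzag_growth (m : ℕ) :
    (m + 3) * eulerZigzag (m + 2) ≤ 2 * eulerZigzag (m + 3) := by
  rw [eulerZigzag_eq_sum, eulerZigzag_eq_sum, sum_alternating_succ m fun _ => 1,
    sum_alternating_succ (m + 1) fun _ => 1,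
    sum_alternating_succ m fun s => ∑ v ∈ Finset.range (m + 1 + 2),
      if CanAppend (m + 1) s v then 1 else 0, Finset.mul_sum, Finset.mul_sum]
  -- The inequality already holds for each fixed `τ` on `m + 1` elements: the left side counts
  -- one-step extensions and the right side two-step extensions.
  refine Finset.sum_le_sum fun τ _ => ?_
  by_cases h : Alternating τ
  swap
  · simp [h]
  rw [if_pos h, if_pos h]
  have hs : (τ (Fin.last m) : ℕ) < m + 1 := (τ (Fin.last m)).2
  generalize (τ (Fin.last m) : ℕ) = s at hs
  by_cases hm : Even m
  · have hm' : ¬ Even (m + 1) := by rw [Nat.even_add_one]; exact not_not.2 hm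
    rw [sum_canAppend_of_even hm, Finset.mul_sum]
    refine (le_sum_of_even s (m + 2)).trans (Finset.sum_le_sum fun v hv => ?_)
    rw [Finset.mem_range] at hv
    by_cases hsv : s < v
    · rw [if_pos hsv, if_pos (by rw [CanAppend, if_pos hm]; exact hsv),
        sum_canAppend_of_odd hm' (s := v) (by omega)]
    · rw [if_neg hsv]
      exact Nat.zero_le _
  · have hm' : Even (m + 1) := Nat.even_add_one.2 hm
    rw [sum_canAppend_of_odd hm (by omega), Finset.mul_sum]
    have h1 := le_sum_of_odd (t := s + 1) (M := m + 2) (by omega)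
    rw [mul_comm] at h1
    refine h1.trans ((Finset.sum_le_sum fun v hv => ?_).trans
      (Finset.sum_le_sum_of_subset (Finset.range_mono (by omega : s + 1 ≤ m + 2))))
    rw [Finset.mem_range] at hv
    have := sum_canAppend_of_even hm' (s := v)
    rw [if_pos (by rw [CanAppend, if_neg hm]; omega), this]

lemma eulerZigzag_three : eulerZigzag 3 = 2 := by decide

/-! ### Words with sorted first and last occurrences -/

/-- The number of occurrences of the letter `x` in the word `g`. -/
def occ {n : ℕ} (g : Fin n → Fin 4) (x : Fin 4) : ℕ := (Finset.univ.filter fun r => g r = x).card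

/-- The suffixes of words in the letters `0, 1, 2, 3` in which each of `1, 2, 3` occurs four times,
with increasing first occurrences and increasing last occurrences. -/
structure SortedSuffix {n : ℕ} (g : Fin n → Fin 4) : Prop where
  le : ∀ x, 0 < x → occ g x ≤ 4
  last : ∀ i j : Fin 4, 0 < i → i < j → ∀ r, g r = i → ∃ r', r < r' ∧ g r' = j
  started : ∀ i j : Fin 4, 0 < i → i < j → occ g j < 4 → occ g i < 4
  first : ∀ i j : Fin 4, 0 < i → i < j → ∀ r, g r = j → (∃ r', r' < r ∧ g r' = i) ∨ occ g i < 4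

/-- An upper bound for the number of sorted suffixes with given numbers of letters. -/
def suffixCount : ℕ → ℕ → ℕ → ℕ → ℕ → ℕ
  | 0, _, _, _, _ => 1
  | n + 1, a, b, c, e =>
    if (e < 4 → c < 4) ∧ (c < 4 → b < 4) ∧ (0 < b → 0 < c) ∧ (0 < c → 0 < e) then
      (if 0 < a then suffixCount n (a - 1) b c e else 0) +
      (if 0 < b then suffixCount n a (b - 1) c e else 0) +
      (if 0 < c then suffixCount n a b (c - 1) e else 0) +
      (if 0 < e then suffixCount n a b c (e - 1) else 0)
    else 0

lemma occ_succ {n : ℕ} (g : Fin (n + 1) → Fin 4) (x : Fin 4) :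
    occ g x = (if g 0 = x then 1 else 0) + occ (Fin.tail g) x := by
  rw [occ, occ, Finset.card_filter, Finset.card_filter, Fin.sum_univ_succ]
  rfl

lemma occ_pos_iff {n : ℕ} (g : Fin n → Fin 4) (x : Fin 4) : 0 < occ g x ↔ ∃ r, g r = x := by
  rw [occ, Finset.card_pos]
  constructor
  · rintro ⟨r, hr⟩; exact ⟨r, by simpa using hr⟩
  · rintro ⟨r, hr⟩; exact ⟨r, by simpa using hr⟩

/-- A letter with fewer than four occurrences left has already appeared in the removed prefix. This
is how first occurrences are remembered; the cap of four makes removing a letter register. -/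
lemma SortedSuffix.tail {n : ℕ} {g : Fin (n + 1) → Fin 4} (h : SortedSuffix g) :
    SortedSuffix (Fin.tail g) := by
  have hle : ∀ x, occ (Fin.tail g) x ≤ occ g x := fun x => by rw [occ_succ g]; omega
  refine ⟨fun x hx => (hle x).trans (h.le x hx), fun i j hi hij r hr => ?_,
    fun i j hi hij hj => ?_, fun i j hi hij r hr => ?_⟩
  · obtain ⟨r', hr', hg⟩ := h.last i j hi hij r.succ hr
    obtain ⟨r'', rfl⟩ := Fin.exists_succ_eq.2 (Fin.ne_zero_of_lt hr')
    exact ⟨r'', Fin.succ_lt_succ_iff.1 hr', hg⟩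
  · refine (hle i).trans_lt ?_
    by_cases h0 : g 0 = j
    · rcases h.first i j hi hij 0 h0 with ⟨r', hr', -⟩ | h'
      · exact absurd hr' (Fin.not_lt_zero r')
      · exact h'
    · refine h.started i j hi hij ?_
      rw [occ_succ, if_neg h0]; omega
  · rcases h.first i j hi hij r.succ hr with ⟨r', hr', hg⟩ | h'
    · by_cases h0 : r' = 0
      · right
        subst h0
        have := h.le i hi
        rw [occ_succ, if_pos hg] at this
        omega
      · obtain ⟨r'', rfl⟩ := Fin.exists_succ_eq.2 h0
        exact Or.inl ⟨r'', Fin.succ_lt_succ_iff.1 hr', hg⟩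
    · exact Or.inr ((hle i).trans_lt h')

/-- The words are split by their first letter, and `SortedSuffix` is inherited by the tail. The
guard in `suffixCount` holds as soon as one such word exists. -/
lemma card_le_suffixCount (n : ℕ) : ∀ (a b c e : ℕ) (S : Finset (Fin n → Fin 4)),
    (∀ g ∈ S, SortedSuffix g ∧ occ g 0 = a ∧ occ g 1 = b ∧ occ g 2 = c ∧ occ g 3 = e) →
    S.card ≤ suffixCount n a b c e := by
  induction n with
  | zero => intro a b c e S _; exact Finset.card_le_one_of_subsingleton S
  | succ n ih =>
    intro a b c e S hS
    rcases S.eq_empty_or_nonempty with rfl | ⟨g0, hg0⟩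
    · simp
    have hvalid : (e < 4 → c < 4) ∧ (c < 4 → b < 4) ∧ (0 < b → 0 < c) ∧ (0 < c → 0 < e) := by
      obtain ⟨h, rfl, rfl, rfl, rfl⟩ := hS g0 hg0
      refine ⟨h.started 2 3 (by decide) (by decide), h.started 1 2 (by decide) (by decide),
        fun hp => ?_, fun hp => ?_⟩
      · obtain ⟨r, hr⟩ := (occ_pos_iff _ _).1 hp
        obtain ⟨r', -, h'⟩ := h.last 1 2 (by decide) (by decide) r hr
        exact (occ_pos_iff _ _).2 ⟨r', h'⟩
      · obtain ⟨r, hr⟩ := (occ_pos_iff _ _).1 hp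
        obtain ⟨r', -, h'⟩ := h.last 2 3 (by decide) (by decide) r hr
        exact (occ_pos_iff _ _).2 ⟨r', h'⟩
    rw [suffixCount, if_pos hvalid,
      Finset.card_eq_sum_card_fiberwise (f := fun g => g 0) (t := Finset.univ) (by simp),
      Fin.sum_univ_four]
    have hfiber : ∀ x : Fin 4, (S.filter fun g => g 0 = x).card =
        ((S.filter fun g => g 0 = x).image Fin.tail).card := by
      intro x
      refine (Finset.card_image_of_injOn fun g hg g' hg' h => ?_).symm
      simp only [Finset.coe_filter, Set.mem_ofPred_eq] at hg hg'
      rw [← Fin.cons_self_tail g, ← Fin.cons_self_tail g', hg.2, hg'.2, h]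
    have hmem : ∀ x : Fin 4, ∀ g ∈ (S.filter fun g => g 0 = x).image Fin.tail,
        ∃ g' ∈ S, g' 0 = x ∧ g = Fin.tail g' := by
      intro x g hg
      simp only [Finset.mem_image, Finset.mem_filter] at hg
      obtain ⟨g', ⟨h1, h2⟩, h3⟩ := hg
      exact ⟨g', h1, h2, h3.symm⟩
    have hempty : ∀ x : Fin 4, (∀ g ∈ S, occ g x = 0) → (S.filter fun g => g 0 = x).card = 0 := by
      intro x hx
      rw [Finset.card_eq_zero, Finset.filter_eq_empty_iff]
      intro g hg h0
      have := hx g hg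
      rw [occ_succ, if_pos h0] at this
      omega
    have hstep : ∀ x : Fin 4, ∀ g ∈ S, g 0 = x → ∀ y,
        occ (Fin.tail g) y = occ g y - if x = y then 1 else 0 := by
      intro x g _ h0 y
      rw [occ_succ g, h0]; omega
    refine Nat.add_le_add (Nat.add_le_add (Nat.add_le_add ?_ ?_) ?_) ?_
    · split_ifs with hp
      · rw [hfiber]
        refine ih _ _ _ _ _ fun g hg => ?_
        obtain ⟨g', hg', h0, rfl⟩ := hmem _ g hg
        obtain ⟨h, rfl, rfl, rfl, rfl⟩ := hS g' hg'
        refine ⟨h.tail, ?_, ?_, ?_, ?_⟩ <;> rw [hstep _ g' hg' h0] <;> rfl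
      · rw [hempty _ fun g hg => by have := (hS g hg).2.1; omega]
    · split_ifs with hp
      · rw [hfiber]
        refine ih _ _ _ _ _ fun g hg => ?_
        obtain ⟨g', hg', h0, rfl⟩ := hmem _ g hg
        obtain ⟨h, rfl, rfl, rfl, rfl⟩ := hS g' hg'
        refine ⟨h.tail, ?_, ?_, ?_, ?_⟩ <;> rw [hstep _ g' hg' h0] <;> rfl
      · rw [hempty _ fun g hg => by have := (hS g hg).2.2.1; omega]
    · split_ifs with hp
      · rw [hfiber]
        refine ih _ _ _ _ _ fun g hg => ?_
        obtain ⟨g', hg', h0, rfl⟩ := hmem _ g hg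
        obtain ⟨h, rfl, rfl, rfl, rfl⟩ := hS g' hg'
        refine ⟨h.tail, ?_, ?_, ?_, ?_⟩ <;> rw [hstep _ g' hg' h0] <;> rfl
      · rw [hempty _ fun g hg => by have := (hS g hg).2.2.2.1; omega]
    · split_ifs with hp
      · rw [hfiber]
        refine ih _ _ _ _ _ fun g hg => ?_
        obtain ⟨g', hg', h0, rfl⟩ := hmem _ g hg
        obtain ⟨h, rfl, rfl, rfl, rfl⟩ := hS g' hg'
        refine ⟨h.tail, ?_, ?_, ?_, ?_⟩ <;> rw [hstep _ g' hg' h0] <;> rfl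
      · rw [hempty _ fun g hg => by have := (hS g hg).2.2.2.2; omega]

lemma suffixCount_eq : suffixCount 13 1 4 4 4 = 16913 := by decide +kernel

/-- The block of a rank: `0` for the root, `j + 1` for the subtree of the `j`-th child. -/
noncomputable def word (w : Equiv.Perm (Fin (N 3 3))) (r : Fin (N 3 3)) : Fin 4 :=
  match (blockEquiv (k := 3) (by omega) 2).symm (w⁻¹ r) with
  | none => 0
  | some x => x.1.succ

lemma word_root (w : Equiv.Perm (Fin (N 3 3))) :
    word w (w (blockEquiv (k := 3) (by omega) 2 none)) = 0 := by
  simp [word]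

lemma word_block (w : Equiv.Perm (Fin (N 3 3))) (j : Fin 3) (i : Fin (N 3 2)) :
    word w (block (k := 3) (by omega) w j i) = j.succ := by
  have : block (k := 3) (by omega) w j i = w (blockEquiv (k := 3) (by omega) 2 (some (j, i))) := rfl
  rw [this]
  simp [word]

lemma word_cases (w : Equiv.Perm (Fin (N 3 3))) (r : Fin (N 3 3)) :
    r = w (blockEquiv (k := 3) (by omega) 2 none) ∨
      ∃ j i, r = block (k := 3) (by omega) w j i := by
  obtain ⟨q, rfl⟩ := w.surjective r
  obtain ⟨y, rfl⟩ := (blockEquiv (k := 3) (by omega) 2).surjective q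
  rcases y with _ | ⟨j, i⟩
  · exact Or.inl rfl
  · exact Or.inr ⟨j, i, rfl⟩

lemma word_eq_succ_iff (w : Equiv.Perm (Fin (N 3 3))) (r : Fin (N 3 3)) (j : Fin 3) :
    word w r = j.succ ↔ ∃ i, r = block (k := 3) (by omega) w j i := by
  constructor
  · intro h
    rcases word_cases w r with rfl | ⟨j', i, rfl⟩
    · rw [word_root] at h
      exact absurd h.symm (Fin.succ_ne_zero j)
    · rw [word_block] at h
      rw [← Fin.succ_injective _ h]
      exact ⟨i, rfl⟩
  · rintro ⟨i, rfl⟩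
    exact word_block w j i

lemma word_eq_zero_iff (w : Equiv.Perm (Fin (N 3 3))) (r : Fin (N 3 3)) :
    word w r = 0 ↔ r = w (blockEquiv (k := 3) (by omega) 2 none) := by
  constructor
  · intro h
    rcases word_cases w r with rfl | ⟨j', i, rfl⟩
    · rfl
    · rw [word_block] at h
      exact absurd h (Fin.succ_ne_zero _)
  · rintro rfl
    exact word_root w

lemma occ_word_succ (w : Equiv.Perm (Fin (N 3 3))) (j : Fin 3) : occ (word w) j.succ = 4 := by
  have : (Finset.univ.filter fun r => word w r = j.succ) =
      Finset.univ.image (block (k := 3) (by omega) w j) := by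
    ext r
    simp only [Finset.mem_filter, Finset.mem_univ, true_and, word_eq_succ_iff, Finset.mem_image,
      eq_comm]
  rw [occ, this, Finset.card_image_of_injective _ (block_injective _ w j), Finset.card_univ,
    Fintype.card_fin]
  decide

lemma occ_word_zero (w : Equiv.Perm (Fin (N 3 3))) : occ (word w) 0 = 1 := by
  rw [occ, Finset.card_eq_one]
  refine ⟨w (blockEquiv (k := 3) (by omega) 2 none), ?_⟩
  ext r
  simp [word_eq_zero_iff]

/-- In the full word each of `1, 2, 3` still has all four occurrences, so `started` is vacuous. The
conditions on first and last occurrences come from the comparison of sibling subtrees. -/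
lemma sortedSuffix_word {w : Equiv.Perm (Fin (N 3 3))} (hw : w ∈ subtreeOrderings 3 3) :
    SortedSuffix (word w) := by
  have hsucc : ∀ x : Fin 4, 0 < x → ∃ j : Fin 3, j.succ = x := fun x hx =>
    Fin.exists_succ_eq.2 hx.ne'
  refine ⟨fun x hx => ?_, fun x y hx hxy r hr => ?_, fun x y hx hxy hy => ?_,
    fun x y hx hxy r hr => ?_⟩
  · obtain ⟨j, rfl⟩ := hsucc x hx
    rw [occ_word_succ]
  · obtain ⟨i, rfl⟩ := hsucc x hx
    obtain ⟨j, rfl⟩ := hsucc y (hx.trans hxy)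
    obtain ⟨a, rfl⟩ := (word_eq_succ_iff w r i).1 hr
    obtain ⟨b, hb⟩ := (block_exists_lt (by omega) hw (Fin.succ_lt_succ_iff.1 hxy) a).2
    exact ⟨_, hb, word_block w j b⟩
  · obtain ⟨j, rfl⟩ := hsucc y (hx.trans hxy)
    rw [occ_word_succ] at hy
    exact absurd hy (lt_irrefl 4)
  · obtain ⟨i, rfl⟩ := hsucc x hx
    obtain ⟨j, rfl⟩ := hsucc y (hx.trans hxy)
    obtain ⟨a, rfl⟩ := (word_eq_succ_iff w r j).1 hr
    obtain ⟨b, hb⟩ := (block_exists_lt (by omega) hw (Fin.succ_lt_succ_iff.1 hxy) a).1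
    exact Or.inl ⟨_, hb, word_block w i b⟩

/-- The word records which ranks belong to each block, and the standardized blocks record their
order inside it. Together they determine the ordering. -/
lemma T_three_three_le : T 3 3 ≤ 16913 * T 3 2 ^ 3 := by
  classical
  let W : Finset (Fin (N 3 3) → Fin 4) := Finset.univ.filter fun g =>
    SortedSuffix g ∧ occ g 0 = 1 ∧ occ g 1 = 4 ∧ occ g 2 = 4 ∧ occ g 3 = 4
  have hW : W.card ≤ 16913 := by
    have h := card_le_suffixCount (N 3 3) 1 4 4 4 W fun g hg => (Finset.mem_filter.1 hg).2
    have h13 : suffixCount (N 3 3) 1 4 4 4 = 16913 := by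
      rw [show N 3 3 = 13 by decide, suffixCount_eq]
    exact h.trans h13.le
  let Φ : subtreeOrderings 3 3 → W × (Fin 3 → subtreeOrderings 3 2) := fun w =>
    (⟨word w.1, Finset.mem_filter.2 ⟨Finset.mem_univ _, sortedSuffix_word w.2, occ_word_zero w.1,
      occ_word_succ w.1 0, occ_word_succ w.1 1, occ_word_succ w.1 2⟩⟩,
      fun j => ⟨standardize (block (k := 3) (by omega) w.1 j),
        standardize_block_mem (by omega) w.2 j⟩)
  have hΦ : Function.Injective Φ := by
    rintro ⟨w, hw⟩ ⟨w', hw'⟩ h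
    simp only [Φ, Prod.mk.injEq, Subtype.mk.injEq] at h
    obtain ⟨h1, h2⟩ := h
    have hstd : ∀ j, standardize (block (k := 3) (by omega) w j) =
        standardize (block (k := 3) (by omega) w' j) :=
      fun j => congrArg Subtype.val (congrFun h2 j)
    refine Subtype.ext (perm_ext_of_block (k := 3) (by omega) ?_ fun j i => ?_)
    · refine (word_eq_zero_iff w' _).1 ?_
      rw [← h1]
      exact word_root w
    · have hr : Set.range (block (k := 3) (by omega) w j) =
          Set.range (block (k := 3) (by omega) w' j) := by
        ext r
        have e1 := word_eq_succ_iff w r j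
        have e2 := word_eq_succ_iff w' r j
        rw [h1] at e1
        simp only [Set.mem_range, eq_comm (b := r)]
        exact e1.symm.trans e2
      have heq := eq_of_strictMono_comp
        (strictMono_standardize (block_injective (k := 3) (by omega) w j))
        (strictMono_standardize (block_injective (k := 3) (by omega) w' j)) hr
      have := congrFun heq (standardize (block (k := 3) (by omega) w j) i)
      rw [← hstd j] at this
      simpa using this
  have h := Nat.card_le_card_of_injective Φ hΦ
  have h' : T 3 3 ≤ W.card * T 3 2 ^ 3 := by
    rw [Nat.card_prod, Nat.card_pi, Nat.card_eq_fintype_card (α := W), Fintype.card_coe] at h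
    simpa only [T, Nat.card_coe_set_eq, Finset.prod_const, Finset.card_univ, Fintype.card_fin] using h
  exact h'.trans (Nat.mul_le_mul_right _ hW)

/-! ### Comparison of the recursive bound with the zigzag bound. -/

/-- The product of the factors of the bound that belong to the subtrees. -/
noncomputable def subtreeFactor (k l : ℕ) : ℚ :=
  ∏ i ∈ Finset.Icc 1 (l - 1), ((T k i : ℚ) / ((N k i).factorial : ℚ)) ^ (k - 1)

lemma subtreeFactor_succ (k l : ℕ) : subtreeFactor k (l + 2) =
    subtreeFactor k (l + 1) * ((T k (l + 1) : ℚ) / ((N k (l + 1)).factorial : ℚ)) ^ (k - 1) := by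
  rw [subtreeFactor, subtreeFactor, show l + 2 - 1 = l + 1 by omega,
    show l + 1 - 1 = l by omega, Finset.prod_Icc_succ_top (by omega)]

lemma subtreeFactor_one (k : ℕ) : subtreeFactor k 1 = 1 := by simp [subtreeFactor]

lemma subtreeFactor_nonneg (k l : ℕ) : 0 ≤ subtreeFactor k l :=
  Finset.prod_nonneg fun _ _ => by positivity

lemma add_five_le_N {k : ℕ} (hk : 2 ≤ k) (m : ℕ) : m + 5 ≤ N k (m + 3) := by
  have h : ∀ l, 2 * N k l + 1 ≤ N k (l + 1) := fun l => by
    rw [N_succ hk]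
    have := Nat.mul_le_mul_right (N k l) hk
    omega
  have h1 := N_one hk
  induction m with
  | zero =>
    have h2 : 2 * N k 1 + 1 ≤ N k 2 := h 1
    have h3 : 2 * N k 2 + 1 ≤ N k 3 := h 2
    change 0 + 5 ≤ N k 3
    omega
  | succ m ih =>
    have := h (m + 3)
    rw [show m + 1 + 3 = m + 3 + 1 by ring]
    omega

lemma cast_factorial_pow {k n : ℕ} (hk : 2 ≤ k) (hn : 1 ≤ n) :
    ((n.factorial : ℕ) : ℚ) ^ (k - 1) =
      n * (((n - 1).factorial : ℚ) * (n.factorial : ℚ) ^ (k - 2)) := by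
  have h : (n.factorial : ℚ) = n * ((n - 1).factorial : ℚ) := by
    rw [← Nat.mul_factorial_pred (by omega)]; push_cast; rfl
  rw [show k - 1 = k - 2 + 1 by omega, pow_succ]
  nth_rewrite 2 [h]
  ring

/-- Replacing `(N - 1)!` by `N! / N` in the two exceptional denominators makes all layers uniform
and produces the factor `N_(l-1) N_(l-2)`; the binomial coefficient absorbs the other factorial. -/
lemma zigzagBound_eq {k : ℕ} (hk : 2 ≤ k) (m : ℕ) : zigzagBound k (m + 3) =
    N k (m + 2) * N k (m + 1) * ((N k (m + 3) - 2).factorial : ℚ) / ((m + 3).factorial : ℚ) *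
      eulerZigzag (m + 3) * subtreeFactor k (m + 3) := by
  have hN := add_five_le_N hk m
  have hchoose : ((N k (m + 3) - 2).choose (m + 3) : ℚ) * ((m + 3).factorial : ℚ) *
      ((N k (m + 3) - (m + 3) - 2).factorial : ℚ) = ((N k (m + 3) - 2).factorial : ℚ) := by
    rw [show N k (m + 3) - (m + 3) - 2 = N k (m + 3) - 2 - (m + 3) by omega]
    exact_mod_cast Nat.choose_mul_factorial_mul_factorial (by omega)
  have h1 := cast_factorial_pow hk (N_pos hk (l := m + 1) (by omega))
  have h2 := cast_factorial_pow hk (N_pos hk (l := m + 2) (by omega))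
  have hp1 : (N k (m + 1) : ℚ) ≠ 0 := by
    exact_mod_cast (N_pos hk (l := m + 1) (by omega)).ne'
  have hp2 : (N k (m + 2) : ℚ) ≠ 0 := by
    exact_mod_cast (N_pos hk (l := m + 2) (by omega)).ne'
  have hfac : ∀ n : ℕ, (n.factorial : ℚ) ≠ 0 := fun n => by exact_mod_cast n.factorial_ne_zero
  have hprod : ∏ i ∈ Finset.Icc 1 m, ((N k i).factorial : ℚ) ^ (k - 1) ≠ 0 :=
    Finset.prod_ne_zero_iff.2 fun i _ => pow_ne_zero _ (hfac _)
  rw [zigzagBound, subtreeFactor]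
  simp only [div_pow, Finset.prod_div_distrib]
  rw [show m + 3 - 1 = m + 1 + 1 by omega, show m + 3 - 2 = m + 1 by omega,
    show m + 3 - 3 = m by omega,
    Finset.prod_Icc_succ_top (f := fun i => ((N k i).factorial : ℚ) ^ (k - 1)) (by omega),
    Finset.prod_Icc_succ_top (f := fun i => ((N k i).factorial : ℚ) ^ (k - 1)) (by omega),
    show m + 1 + 1 = m + 2 by omega, h1, h2, ← hchoose]
  have g1 := hfac (N k (m + 1) - 1)
  have g2 := hfac (N k (m + 2) - 1)
  have g3 := pow_ne_zero (k - 2) (hfac (N k (m + 1)))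
  have g4 := pow_ne_zero (k - 2) (hfac (N k (m + 2)))
  have g5 := hfac (m + 3)
  field_simp

lemma zigzagBound_nonneg {k : ℕ} (hk : 2 ≤ k) (m : ℕ) : 0 ≤ zigzagBound k (m + 3) := by
  rw [zigzagBound_eq hk]
  exact mul_nonneg (by positivity) (subtreeFactor_nonneg _ _)

/-- The recursive bound in terms of the fraction of orderings that occur. -/
lemma T_succ_le {k l : ℕ} (hk : 2 ≤ k) (hl : 1 ≤ l) : (T k (l + 1) : ℚ) ≤
    ((N k (l + 1)).factorial : ℚ) / (k.factorial : ℚ) * ((T k l : ℚ) / ((N k l).factorial : ℚ)) *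
      ((T k l : ℚ) / ((N k l).factorial : ℚ)) ^ (k - 1) := by
  have h : (T k (l + 1) : ℚ) * ((k.factorial : ℚ) * ((N k l).factorial : ℚ) ^ k) ≤
      ((N k (l + 1)).factorial : ℚ) * (T k l : ℚ) ^ k := by
    exact_mod_cast T_succ_mul_le hk hl
  rw [mul_assoc, ← pow_succ', show k - 1 + 1 = k by omega, div_pow, div_mul_div_comm,
    le_div_iff₀ (by positivity)]
  exact h

lemma cast_factorial_sub_two {n : ℕ} (hn : 2 ≤ n) :
    (n.factorial : ℚ) = n * (n - 1) * ((n - 2).factorial : ℚ) := by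
  obtain ⟨n, rfl⟩ := Nat.exists_eq_add_of_le' hn
  rw [Nat.factorial_succ, Nat.factorial_succ, Nat.add_sub_cancel]
  push_cast
  ring

lemma cast_N_succ {k : ℕ} (hk : 2 ≤ k) (l : ℕ) : (N k (l + 1) : ℚ) = k * N k l + 1 := by
  rw [N_succ hk]; push_cast; ring

/-- Since `N_(l+1) - 1 = k N_l`, the quotient of the factorials is explicit. What is left splits
into one inequality between layer sizes and one between zigzag numbers. -/
lemma T_le_zigzagBound_succ {k : ℕ} (hk : 2 ≤ k) (m : ℕ)
    (ih : (T k (m + 3) : ℚ) ≤ zigzagBound k (m + 3)) :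
    (T k (m + 4) : ℚ) ≤ zigzagBound k (m + 4) := by
  have hA : ((m : ℚ) + 4) * eulerZigzag (m + 3) ≤ (k.factorial : ℚ) * eulerZigzag (m + 4) := by
    have h1 : ((m : ℚ) + 4) * eulerZigzag (m + 3) ≤ 2 * eulerZigzag (m + 4) := by
      exact_mod_cast eulerZigzag_growth (m + 1)
    have h2 : (2 : ℚ) ≤ (k.factorial : ℚ) := by
      exact_mod_cast hk.trans (Nat.self_le_factorial k)
    exact h1.trans (mul_le_mul_of_nonneg_right h2 (by positivity))
  have e4 := cast_N_succ hk (m + 3)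
  have e3 := cast_N_succ hk (m + 2)
  have e2 := cast_N_succ hk (m + 1)
  have hp1 : (0 : ℚ) < N k (m + 1) := by exact_mod_cast N_pos hk (l := m + 1) (by omega)
  have hp2 : (0 : ℚ) < N k (m + 2) := by exact_mod_cast N_pos hk (l := m + 2) (by omega)
  have hp3 : (0 : ℚ) < N k (m + 3) := by exact_mod_cast N_pos hk (l := m + 3) (by omega)
  have hp4 : (0 : ℚ) < N k (m + 4) := by exact_mod_cast N_pos hk (l := m + 4) (by omega)
  have h13 : (N k (m + 1) : ℚ) ≤ N k (m + 3) := by exact_mod_cast N_mono hk (by omega)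
  -- By the recursion for `N`, the right side minus the left side is `N k (m + 3) - N k (m + 1)`.
  have hN : (N k (m + 4) : ℚ) * N k (m + 1) ≤ N k (m + 3) * N k (m + 2) := by
    rw [e4, e2]; nlinarith
  have hk0 : (0 : ℚ) < k := by exact_mod_cast (by omega : 0 < k)
  have hf4 := cast_factorial_sub_two (n := N k (m + 4))
    (by have := add_five_le_N hk (m + 1); rw [show m + 1 + 3 = m + 4 by ring] at this; omega)
  have hf3 := cast_factorial_sub_two (n := N k (m + 3)) (by have := add_five_le_N hk m; omega)
  have hfl : ((m + 4).factorial : ℚ) = (m + 4) * ((m + 3).factorial : ℚ) := by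
    rw [Nat.factorial_succ]; push_cast; ring
  refine (T_succ_le hk (by omega : 1 ≤ m + 3)).trans ?_
  rw [zigzagBound_eq hk] at ih
  rw [show m + 4 = m + 1 + 3 by ring, zigzagBound_eq hk (m + 1)]
  rw [show m + 1 + 3 = m + 4 by ring, show m + 1 + 2 = m + 3 by ring, show m + 1 + 1 = m + 2 by ring,
    show subtreeFactor k (m + 4) = _ from subtreeFactor_succ k (m + 2), ← mul_assoc]
  rw [show m + 2 + 1 = m + 3 by ring]
  refine mul_le_mul_of_nonneg_right ?_ (by positivity)
  have hQ := subtreeFactor_nonneg k (m + 3)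
  set Q := subtreeFactor k (m + 3)
  set X : ℚ := ((N k (m + 4) - 2).factorial : ℚ) with hX
  set Y : ℚ := ((N k (m + 3) - 2).factorial : ℚ) with hY
  have hXpos : 0 < X := by positivity
  have hYpos : 0 < Y := by positivity
  have hkf : (0 : ℚ) < k.factorial := by positivity
  have hmf : (0 : ℚ) < (m + 3).factorial := by positivity
  have step1 : ((N k (m + 4)).factorial : ℚ) / (k.factorial : ℚ) *
      ((T k (m + 3) : ℚ) / ((N k (m + 3)).factorial : ℚ)) ≤
      ((N k (m + 4)).factorial : ℚ) / (k.factorial : ℚ) *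
      ((N k (m + 2) * N k (m + 1) * Y / ((m + 3).factorial : ℚ) * eulerZigzag (m + 3) * Q) /
        ((N k (m + 3)).factorial : ℚ)) := by
    gcongr
  refine step1.trans ?_
  have hL : ((N k (m + 4)).factorial : ℚ) / (k.factorial : ℚ) *
      ((N k (m + 2) * N k (m + 1) * Y / ((m + 3).factorial : ℚ) * eulerZigzag (m + 3) * Q) /
        ((N k (m + 3)).factorial : ℚ)) =
      (N k (m + 4) * N k (m + 1)) * (((m : ℚ) + 4) * eulerZigzag (m + 3)) *
        (X * Q / ((k.factorial : ℚ) * ((m + 3).factorial : ℚ) * (m + 4))) := by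
    have h4 : (N k (m + 4) : ℚ) - 1 = k * N k (m + 3) := by rw [e4]; ring
    have h3 : (N k (m + 3) : ℚ) - 1 = k * N k (m + 2) := by rw [e3]; ring
    rw [hf4, hf3, h4, h3]
    field_simp
  have hR : (N k (m + 3) : ℚ) * N k (m + 2) * X / ((m + 4).factorial : ℚ) * eulerZigzag (m + 4) * Q =
      (N k (m + 3) * N k (m + 2)) * ((k.factorial : ℚ) * eulerZigzag (m + 4)) *
        (X * Q / ((k.factorial : ℚ) * ((m + 3).factorial : ℚ) * (m + 4))) := by
    rw [hfl]
    field_simp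
  rw [hL, hR]
  gcongr

/-- This is what the recursive bound needs at three layers. It fails for `k = 2` and `k = 3`, hence
the separate treatment of these cases. -/
lemma three_mul_le_factorial_sq {k : ℕ} (hk : 4 ≤ k) :
    3 * k * (k ^ 2 + k + 1) ≤ k.factorial * k.factorial := by
  obtain ⟨j, rfl⟩ := Nat.exists_eq_add_of_le' hk
  have h : (j + 4) * ((j + 3) * (j + 2)) ≤ (j + 4).factorial := by
    rw [Nat.factorial_succ, Nat.factorial_succ, Nat.factorial_succ]
    have := Nat.factorial_pos (j + 1)
    nlinarith [Nat.mul_le_mul_left ((j + 4) * (j + 3) * (j + 2)) this]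
  refine le_trans ?_ (Nat.mul_le_mul h h)
  have : 3 * ((j + 4) ^ 2 + (j + 4) + 1) ≤
      (j + 3) * (j + 2) * ((j + 4) * ((j + 3) * (j + 2))) := by
    nlinarith [Nat.zero_le j, Nat.zero_le (j ^ 2), Nat.zero_le (j ^ 3), Nat.zero_le (j ^ 4),
      Nat.zero_le (j ^ 5)]
  calc 3 * (j + 4) * ((j + 4) ^ 2 + (j + 4) + 1)
      = (j + 4) * (3 * ((j + 4) ^ 2 + (j + 4) + 1)) := by ring
    _ ≤ (j + 4) * ((j + 3) * (j + 2) * ((j + 4) * ((j + 3) * (j + 2)))) :=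
        Nat.mul_le_mul_left _ this
    _ = _ := by ring

lemma T_two_le {k : ℕ} (hk : 2 ≤ k) : T k 2 ≤ k + 1 := by
  have h := T_succ_mul_le hk (le_refl 1)
  have hN : N k 2 = k + 1 := by rw [N_succ hk, N_one hk]; ring
  rw [show 1 + 1 = 2 by rfl, hN, N_one hk, Nat.factorial_one, one_pow, mul_one,
    Nat.factorial_succ] at h
  have hT : T k 1 ^ k ≤ 1 := pow_le_one₀ (Nat.zero_le _) (T_one_le hk)
  have h2 : T k 2 * k.factorial ≤ (k + 1) * k.factorial :=
    h.trans (by simpa using Nat.mul_le_mul_left ((k + 1) * k.factorial) hT)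
  exact Nat.le_of_mul_le_mul_right h2 k.factorial_pos

lemma T_three_le_zigzagBound {k : ℕ} (hk : 2 ≤ k) : (T k 3 : ℚ) ≤ zigzagBound k 3 := by
  -- In the positive case `T k 2 ≥ 1`; the binary case needs this, its bound being `20 * T 2 2`.
  rcases Nat.eq_zero_or_pos (T k 3) with h0 | hpos
  · rw [h0, Nat.cast_zero]; exact zigzagBound_nonneg hk 0
  have hT2 : 0 < T k 2 := T_pos_of_succ hk hpos
  have hT1 : T k 1 = 1 := le_antisymm (T_one_le hk) (T_pos_of_succ hk hT2)
  have hN2 : N k 2 = k + 1 := by rw [N_succ hk, N_one hk]; ring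
  have hN3 : N k 3 = k ^ 2 + k + 1 := by rw [N_succ hk, hN2]; ring
  have hbound : zigzagBound k 3 = ((k + 1 : ℕ) : ℚ) * ((N k 3 - 2).factorial : ℚ) / 3 *
      ((T k 2 : ℚ) / ((k + 1).factorial : ℚ)) ^ (k - 1) := by
    have h := zigzagBound_eq hk 0
    have hQ : subtreeFactor k 3 = ((T k 2 : ℚ) / ((k + 1).factorial : ℚ)) ^ (k - 1) := by
      rw [subtreeFactor_succ k 1, subtreeFactor_succ k 0, subtreeFactor_one, hT1, hN2, N_one hk]
      simp
    simp only [zero_add] at h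
    rw [h, hQ, eulerZigzag_three, N_one hk, hN2, show (3 : ℕ).factorial = 6 by rfl]
    push_cast
    ring
  rw [hbound]
  rcases (by omega : k = 2 ∨ k = 3 ∨ 4 ≤ k) with rfl | rfl | hk4
  · have h : (T 2 3 : ℚ) ≤ 20 := by exact_mod_cast T_two_three_le
    have h2 : (1 : ℚ) ≤ T 2 2 := by exact_mod_cast hT2
    have : (T 2 3 : ℚ) ≤ 20 * T 2 2 := by linarith
    refine this.trans (le_of_eq ?_)
    rw [show N 2 3 = 7 by decide]
    norm_num [Nat.factorial]
    ring
  · have h : (T 3 3 : ℚ) ≤ 16913 * (T 3 2 : ℚ) ^ 3 := by exact_mod_cast T_three_three_le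
    have h2 : (T 3 2 : ℚ) ≤ 4 := by exact_mod_cast T_two_le hk
    -- The bound for `k = 3` is `4 * 11! / 3 / 24^2 = 92400` times `T 3 2 ^ 2`, and `16913 * 4 =
    -- 67652` is smaller than 92400.
    have h3 : (T 3 3 : ℚ) ≤ 92400 * (T 3 2 : ℚ) ^ 2 := by
      have : (16913 : ℚ) * (T 3 2 : ℚ) ^ 3 = (16913 * T 3 2) * (T 3 2 : ℚ) ^ 2 := by ring
      rw [this] at h
      refine h.trans (mul_le_mul_of_nonneg_right ?_ (by positivity))
      linarith
    refine h3.trans (le_of_eq ?_)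
    rw [show N 3 3 = 13 by decide]
    norm_num [Nat.factorial]
    ring
  · refine (T_succ_le hk (by omega : 1 ≤ 2)).trans ?_
    rw [show 2 + 1 = 3 by rfl, hN2]
    refine mul_le_mul_of_nonneg_right ?_ (by positivity)
    have hT : (T k 2 : ℚ) ≤ ((k + 1 : ℕ) : ℚ) := by exact_mod_cast T_two_le hk
    have hf := cast_factorial_sub_two (n := N k 3) (by rw [hN3]; nlinarith)
    have hkf : (3 * k * (k ^ 2 + k + 1) : ℚ) ≤ (k.factorial : ℚ) * (k.factorial : ℚ) := by
      exact_mod_cast three_mul_le_factorial_sq hk4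
    have hX : (0 : ℚ) < ((N k 3 - 2).factorial : ℚ) := by positivity
    have hN3' : (N k 3 : ℚ) = (k : ℚ) ^ 2 + k + 1 := by rw [hN3]; push_cast; ring
    have hfk : ((k + 1).factorial : ℚ) = (k + 1) * (k.factorial : ℚ) := by
      rw [Nat.factorial_succ]; push_cast; ring
    have hkpos : (0 : ℚ) < k.factorial := by positivity
    calc ((N k 3).factorial : ℚ) / (k.factorial : ℚ) * ((T k 2 : ℚ) / ((k + 1).factorial : ℚ))
        ≤ ((N k 3).factorial : ℚ) / (k.factorial : ℚ) *
            (((k + 1 : ℕ) : ℚ) / ((k + 1).factorial : ℚ)) := by gcongr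
      _ = (3 * k * (k ^ 2 + k + 1)) * (((k + 1 : ℕ) : ℚ) * ((N k 3 - 2).factorial : ℚ) / 3 /
            ((k.factorial : ℚ) * (k.factorial : ℚ))) := by
          rw [hf, hN3', hfk]
          push_cast
          field_simp
          ring
      _ ≤ ((k.factorial : ℚ) * (k.factorial : ℚ)) * (((k + 1 : ℕ) : ℚ) *
            ((N k 3 - 2).factorial : ℚ) / 3 / ((k.factorial : ℚ) * (k.factorial : ℚ))) := by gcongr
      _ = _ := by field_simp

lemma T_le_zigzagBound {k : ℕ} (hk : 2 ≤ k) (m : ℕ) :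
    (T k (m + 3) : ℚ) ≤ zigzagBound k (m + 3) := by
  induction m with
  | zero => exact T_three_le_zigzagBound hk
  | succ m ih => exact T_le_zigzagBound_succ hk m ih

end ChipFiring

theorem mainTheorem8 (k l : ℕ) (hk : 2 ≤ k) (hl : 3 ≤ l) :
    (ChipFiring.stableConfigs k l).Finite ∧
      (ChipFiring.Z k l : ℚ) ≤ ChipFiring.zigzagBound k l ∧
      (ChipFiring.T k l : ℚ) ≤ ChipFiring.zigzagBound k l := by
  obtain ⟨m, rfl⟩ := Nat.exists_eq_add_of_le' hl
  have hT := ChipFiring.T_le_zigzagBound hk m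
  refine ⟨ChipFiring.stableConfigs_finite hk (by omega), ?_, hT⟩
  exact le_trans (by exact_mod_cast ChipFiring.Z_le_T hk (by omega)) hT
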